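/- For $m\ge 1$ put $\gamma^{[2m]}=\frac12+\frac i2\,\frac{\sin(\pi/(2m+1))}{1+\cos(\pi/(2m+1))}$, and fix $n\ge 1$. Write $\gamma'=\gamma^{[2n+2]}$, $\gamma=\gamma^{[2n]}$. Setting. Let $f$ be a holomorphic vector field on an open set $U\subseteq\mathbb C^d$ (for instance the holomorphic extension of a real analytic vector field), with exact flow $\varphi_h$, and let $\mathcal S_h$ be a one-step method, holomorphic in $(h,x)$ near $\{0\}\times U$. A method $M_h$ has order $r$ if $M_h(x)=\varphi_h(x)+\mathcal O(h^{r+1})$ as $h\to0$, is time-symmetric if $M_h\circ M_{-h}=\mathrm{id}$, and is pseudo-symmetric of order $q$ if $M_h(M_{-h}(x))=x+\mathcal O(h^{q+1})$, for every $x\in U$. Denote by $(\alpha_1,\dots,\alpha_s)$ the composition $\mathcal S_{\alpha_1h}\circ\cdots\circ\mathcal S_{\alpha_sh}$; it is symmetric-conjugate if $\bar\alpha_{s+1-j}=\alpha_j$ for all $j$, and consistent if $\sum_j\alpha_j=1$. Let $$\psi^{(1)}_h=(\gamma'\gamma,\ \gamma'\bar\gamma,\ \bar\gamma'\gamma,\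 \bar\gamma'\bar\gamma),\qquad \psi^{(2)}_h=(\gamma'\bar\gamma,\ \gamma'\gamma,\ \bar\gamma'\bar\gamma,\ \bar\gamma'\gamma),$$ let $\overline\psi{}^{(1)}_h,\overline\psi{}^{(2)}_h$ be the compositions with the complex conjugate coefficients, and $$T_h^{(2)}=\tfrac14\big(\psi_h^{(1)}+\psi_h^{(2)}+\overline\psi{}_h^{(1)}+\overline\psi{}_h^{(2)}\big).$$ Formal exponent. In formal power series in $h$ over the free associative algebra on letters $Y_1,Y_{2n+1},Y_{2n+3},\dots$, let $Y(h)=hY_1+\sum_{j\ge0}h^{2n+2j+1}Y_{2n+2j+1}$ and associate with $(\alpha_1,\dots,\alpha_s)$ the series $V(h)=\log\big(e^{Y(h\alpha_s)}\cdots e^{Y(h\alpha_1)}\big)$. For real numbers $\mu_{2n+1,1},\sigma_{2n+2,1},\mu_{2n+3,1},\mu_{2n+3,2}$ consider the expansion $$V(h)=hY_1+h^{2n+1}\mu_{2n+1,1}Y_{2n+1}+i\,h^{2n+2}\sigma_{2n+2,1}[Y_1,Y_{2n+1}]+h^{2n+3}\big(\mu_{2n+3,1}Y_{2n+3}+\mu_{2n+3,2}[Y_1,[Y_1,Y_{2n+1}]]\big)+\mathcal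 O(h^{2n+4}).\quad(*)$$ Statement. (1) All four compositions in $T^{(2)}_h$ are consistent and symmetric-conjugate. (2) $\psi^{(1)}$ and $\psi^{(2)}$ have expansions of the form $(*)$ with $\mu^{(j)}_{2n+1,1}=\mu^{(j)}_{2n+3,1}=0$ for $j=1,2$ and $\mu^{(2)}_{2n+3,2}=-\mu^{(1)}_{2n+3,2}\neq0$, so that the $\mu_{2n+3,2}$ terms of the two paired compositions cancel. (3) For every $d$, $U$, $f$ and $\mathcal S_h$ as above with $\mathcal S_h$ time-symmetric and of order $2n$, the method $T_h^{(2)}$ is of order $2n+4$ and pseudo-symmetric of order $4n+3$. (4) If moreover $\mathcal S_h$ is real, i.e. $\mathcal S_{\bar h}(\bar x)=\overline{\mathcal S_h(x)}$ near the points $(0,x)$ with $x\in U$ real, then for each real $x\in U$ and all sufficiently small real $h$, $\overline\psi{}^{(j)}_h(x)$ is the complex conjugate of $\psi^{(j)}_h(x)$ for $j=1,2$, and $T^{(2)}_h(x)=\frac12\,\Re\big(\psi_h^{(1)}(x)+\psi_h^{(2)}(x)\big)$. -/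

import Mathlib

open Filter Topology Asymptotics
open scoped ComplexConjugate

noncomputable section

namespace TMethod

/-! ### Numerical methods -/

/-- `φ` is the exact (complex-time, local) flow of `x' = f x` on `U`: for every initial value
`x ∈ U`, the curve `t ↦ φ t x` starts at `x` and solves the equation for all small times. -/
def IsExactFlow {d : ℕ} (f : (Fin d → ℂ) → (Fin d → ℂ)) (U : Set (Fin d → ℂ))
    (φ : ℂ → (Fin d → ℂ) → (Fin d → ℂ)) : Prop :=
  ∀ x ∈ U, φ 0 x = x ∧ ∀ᶠ h in 𝓝 (0 : ℂ), HasDerivAt (fun t => φ t x) (f (φ h x)) h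

/-- The one-step map `M` depends holomorphically on step size and point, near `{0} × U`. -/
def IsHolomorphicMethod {d : ℕ} (U : Set (Fin d → ℂ))
    (M : ℂ → (Fin d → ℂ) → (Fin d → ℂ)) : Prop :=
  ∀ x ∈ U, AnalyticAt ℂ (fun p : ℂ × (Fin d → ℂ) => M p.1 p.2) (0, x)

/-- The method `M` is of order `r`: `M_h(x) = φ_h(x) + O(h^(r+1))`, where `φ` is the exact flow. -/
def HasOrder {d : ℕ} (U : Set (Fin d → ℂ)) (φ M : ℂ → (Fin d → ℂ) → (Fin d → ℂ)) (r : ℕ) :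
    Prop :=
  ∀ x ∈ U, (fun h : ℂ => M h x - φ h x) =O[𝓝 0] (fun h : ℂ => h ^ (r + 1))

/-- The method `M` is time-symmetric: `M_h ∘ M_{-h} = id` (for small `h` at each point). -/
def IsTimeSymmetric {d : ℕ} (U : Set (Fin d → ℂ)) (M : ℂ → (Fin d → ℂ) → (Fin d → ℂ)) : Prop :=
  ∀ x ∈ U, ∀ᶠ h in 𝓝 (0 : ℂ), M h (M (-h) x) = x

/-- The method `M` is pseudo-symmetric of order `q`: `M_h ∘ M_{-h} = id + O(h^(q+1))`. -/
def IsPseudoSymmetric {d : ℕ} (U : Set (Fin d → ℂ)) (M : ℂ → (Fin d → ℂ) → (Fin d → ℂ))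
    (q : ℕ) : Prop :=
  ∀ x ∈ U, (fun h : ℂ => M h (M (-h) x) - x) =O[𝓝 0] (fun h : ℂ => h ^ (q + 1))

/-- The method `M` is real: near the real points of `U` (and step size `0`) it commutes with
complex conjugation; in particular `M_h(x)` is real for real `h` and `x`. -/
def IsRealMethod {d : ℕ} (U : Set (Fin d → ℂ)) (M : ℂ → (Fin d → ℂ) → (Fin d → ℂ)) : Prop :=
  ∀ x ∈ U, star x = x →
    ∀ᶠ p in 𝓝 ((0 : ℂ), x), M (conj p.1) (star p.2) = star (M p.1 p.2)

/-- The composition `(α₁, …, α_s)`, i.e. `S_{α₁ h} ∘ S_{α₂ h} ∘ ⋯ ∘ S_{α_s h}`. -/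
def composition {d : ℕ} (S : ℂ → (Fin d → ℂ) → (Fin d → ℂ)) (α : List ℂ) (h : ℂ) :
    (Fin d → ℂ) → (Fin d → ℂ) :=
  α.foldr (fun a g => S (a * h) ∘ g) id

/-- A symmetric-conjugate sequence of coefficients: `conj α_{s+1-j} = α_j` for all `j`. -/
def IsSymmetricConjugate (α : List ℂ) : Prop :=
  α.reverse.map (fun a => conj a) = α

/-! ### The method -/

/-- The coefficient `γ^[m] = 1/2 + (i/2) sin(π/(m+1)) / (1 + cos(π/(m+1)))`, used for `m` even. -/
def gam (m : ℕ) : ℂ :=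
  1 / 2 + Complex.I / 2 *
    ((Real.sin (Real.pi / (m + 1)) / (1 + Real.cos (Real.pi / (m + 1))) : ℝ) : ℂ)

/-- The coefficients of the first composition. -/
def coeffs₁ (n : ℕ) : List ℂ :=
  [gam (2 * n + 2) * gam (2 * n), gam (2 * n + 2) * conj (gam (2 * n)),
    conj (gam (2 * n + 2)) * gam (2 * n), conj (gam (2 * n + 2)) * conj (gam (2 * n))]

/-- The coefficients of the second composition. -/
def coeffs₂ (n : ℕ) : List ℂ :=
  [gam (2 * n + 2) * conj (gam (2 * n)), gam (2 * n + 2) * gam (2 * n),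
    conj (gam (2 * n + 2)) * conj (gam (2 * n)), conj (gam (2 * n + 2)) * gam (2 * n)]

/-- The coefficients of the third composition. -/
def coeffs₃ (n : ℕ) : List ℂ :=
  [conj (gam (2 * n + 2)) * conj (gam (2 * n)), conj (gam (2 * n + 2)) * gam (2 * n),
    gam (2 * n + 2) * conj (gam (2 * n)), gam (2 * n + 2) * gam (2 * n)]

/-- The coefficients of the fourth composition. -/
def coeffs₄ (n : ℕ) : List ℂ :=
  [conj (gam (2 * n + 2)) * gam (2 * n), conj (gam (2 * n + 2)) * conj (gam (2 * n)),
    gam (2 * n + 2) * gam (2 * n), gam (2 * n + 2) * conj (gam (2 * n))]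

/-- The method `T_h^(2)` built on the basic method `S` of order `2n`. -/
def T₂ {d : ℕ} (n : ℕ) (S : ℂ → (Fin d → ℂ) → (Fin d → ℂ)) (h : ℂ) (x : Fin d → ℂ) :
    Fin d → ℂ :=
  (1 / 4 : ℂ) • (composition S (coeffs₁ n) h x + composition S (coeffs₂ n) h x +
    composition S (coeffs₃ n) h x + composition S (coeffs₄ n) h x)

/-! ### The formal exponent of a composition

Formal power series in `h` whose coefficients are noncommutative polynomials in letters `Y k`. -/

/-- Formal power series in `h` over the free algebra on the letters `Y 0, Y 1, Y 2, …`. -/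
abbrev OpSeries : Type := PowerSeries (FreeAlgebra ℂ ℕ)

/-- The letter `Y k`. -/
def Y (k : ℕ) : FreeAlgebra ℂ ℕ := FreeAlgebra.ι ℂ k

/-- The series `Y(a h)`, where `Y(h) = h Y₁ + h^(2n+1) Y_{2n+1} + h^(2n+3) Y_{2n+3} + ⋯` is the
exponent of a time-symmetric basic method of order `2n`. -/
def basicExponent (n : ℕ) (a : ℂ) : OpSeries :=
  PowerSeries.mk fun k => if k = 1 ∨ (Odd k ∧ 2 * n + 1 ≤ k) then a ^ k • Y k else 0

/-- The formal exponential of a series `Z` without constant term. -/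
def formalExp (Z : OpSeries) : OpSeries :=
  PowerSeries.mk fun m =>
    ∑ k ∈ Finset.range (m + 1), ((k.factorial : ℂ)⁻¹) • PowerSeries.coeff m (Z ^ k)

/-- The formal logarithm `∑_{k ≥ 1} (-1)^(k+1) (P - 1)^k / k` of a series `P` with constant
term `1`. -/
def formalLog (P : OpSeries) : OpSeries :=
  PowerSeries.mk fun m =>
    ∑ k ∈ Finset.Icc 1 m, ((-1 : ℂ) ^ (k + 1) / (k : ℂ)) • PowerSeries.coeff m ((P - 1) ^ k)

/-- The series `V(h)` of the composition `(α₁, …, α_s)`: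
`exp(V(h)) = exp(Y(h α_s)) ⋯ exp(Y(h α₂)) exp(Y(h α₁))`. -/
def exponent (n : ℕ) (α : List ℂ) : OpSeries :=
  formalLog (α.map fun a => formalExp (basicExponent n a)).reverse.prod

/-- The exponent of the composition with coefficients `α` has the expansion
`V(h) = h Y₁ + h^(2n+1) μ_{2n+1,1} Y_{2n+1} + i h^(2n+2) σ_{2n+2,1} [Y₁, Y_{2n+1}]
  + h^(2n+3) (μ_{2n+3,1} Y_{2n+3} + μ_{2n+3,2} [Y₁, [Y₁, Y_{2n+1}]]) + O(h^(2n+4))`. -/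
structure HasExpansion (n : ℕ) (α : List ℂ) (μ11 σ21 μ31 μ32 : ℝ) : Prop where
  coeff_zero : PowerSeries.coeff 0 (exponent n α) = 0
  coeff_one : PowerSeries.coeff 1 (exponent n α) = Y 1
  coeff_mid : ∀ k, 2 ≤ k → k ≤ 2 * n → PowerSeries.coeff k (exponent n α) = 0
  coeff_first : PowerSeries.coeff (2 * n + 1) (exponent n α) = (μ11 : ℂ) • Y (2 * n + 1)
  coeff_second : PowerSeries.coeff (2 * n + 2) (exponent n α) =
    (Complex.I * (σ21 : ℂ)) • ⁅Y 1, Y (2 * n + 1)⁆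
  coeff_third : PowerSeries.coeff (2 * n + 3) (exponent n α) =
    (μ31 : ℂ) • Y (2 * n + 3) + (μ32 : ℂ) • ⁅Y 1, ⁅Y 1, Y (2 * n + 1)⁆⁆

end TMethod

end

/-! A method is encoded by the Taylor series in h of the linear operators g ↦ g ∘ M_h on holomorphic
functions (`HasSeries`). Composing methods multiplies these series in reverse order, scaling the
step rescales h, and the exact flow has series exp(hX), with X the Lie derivative along f. The
analytic claims thus become identities between power series over a noncommutative algebra, and the
same identities give the formal exponents.

Put N = 2n+1. Time symmetry forces P(h) = exp(hX) + h^N (Z + (h/2)(XZ + ZX) + h² W + ⋯)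
(`isPerturbed_scaleHom`). Write g, k for γ and its conjugate, p, q for γ' and its conjugate. Since
γ^[m] has argument π/(2(m+1)), its power m+1 is purely imaginary, so g^N + k^N = 0 and p^(N+2) +
q^(N+2) = 0. The first identity removes Z from each inner pair; the second removes the uncontrolled
term at h^(N+2) from the outer pair. There remain a multiple of [X,Z] at h^(N+1), and multiples of
[X,[X,Z]] and X[X,Z] + [X,Z]X at h^(N+2) (`isPerturbed_quad`). The symmetric product disappears in
the logarithm. Exchanging g and k changes the sign of every remaining term, so the average agrees
with exp(hX) through h^(2n+3) (`coeff_average_quad`).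

Reversing a coefficient list produces the adjoint composition, which is again one of the four. The
four series agree through h^(2n+1), so products of two differences are O(h^(4n+4)). This makes the
averaged series symmetric to that order (`average_symmetric`), and to the same order it is the
series of the averaged map (`HasSeries.average`). Finally, symmetry rules out a leading error at an
even power of h (`coeff_eq_of_symmetric`), which raises the order from 2n+3 to 2n+4. -/

noncomputable section

namespace TMethod

/-! ### Series over a noncommutative algebra -/

section Algebra

open PowerSeries (coeff)

section Ring

variable {A : Type*} [Ring A]

/-- Truncation: `R` agrees with `E` below `h ^ N`, with remainder `h ^ N G`. -/
lemma exists_eq_add_X_pow_mul {R E : PowerSeries A} {N : ℕ}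
    (h : ∀ k < N, coeff k R = coeff k E) :
    ∃ G, R = E + PowerSeries.X ^ N * G ∧ ∀ j, coeff j G = coeff (j + N) R - coeff (j + N) E := by
  refine ⟨PowerSeries.mk fun j => coeff (j + N) R - coeff (j + N) E, ?_, fun j => by simp⟩
  ext m
  by_cases hm : N ≤ m
  · obtain ⟨d, rfl⟩ := Nat.exists_eq_add_of_le' hm
    simp [PowerSeries.coeff_X_pow_mul]
  · simp [PowerSeries.coeff_X_pow_mul', hm, h m (by omega)]

lemma coeff_zero_mul' (f g : PowerSeries A) : coeff 0 (f * g) = coeff 0 f * coeff 0 g := by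
  simp

lemma coeff_one_mul' (f g : PowerSeries A) :
    coeff 1 (f * g) = coeff 0 f * coeff 1 g + coeff 1 f * coeff 0 g := by
  rw [PowerSeries.coeff_mul, Finset.Nat.sum_antidiagonal_eq_sum_range_succ_mk]
  simp [Finset.sum_range_succ]

lemma coeff_two_mul' (f g : PowerSeries A) :
    coeff 2 (f * g) = coeff 0 f * coeff 2 g + coeff 1 f * coeff 1 g + coeff 2 f * coeff 0 g := by
  rw [PowerSeries.coeff_mul, Finset.Nat.sum_antidiagonal_eq_sum_range_succ_mk]
  simp [Finset.sum_range_succ]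

end Ring

variable {A : Type*} [Ring A] [Algebra ℂ A]

/-- The substitution `h ↦ h x`, from scalar power series to series over the algebra of `x`. -/
def powHom (x : A) : PowerSeries ℂ →+* PowerSeries A where
  toFun f := PowerSeries.mk fun m => coeff m f • x ^ m
  map_zero' := by ext; simp
  map_one' := by
    ext m
    by_cases h : m = 0 <;> simp [PowerSeries.coeff_one, h]
  map_add' f g := by ext; simp [add_smul]
  map_mul' f g := by
    ext m
    simp only [PowerSeries.coeff_mk, PowerSeries.coeff_mul, Finset.sum_smul]
    refine Finset.sum_congr rfl fun p hp => ?_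
    rw [smul_mul_smul_comm, ← pow_add, Finset.HasAntidiagonal.mem_antidiagonal.mp hp]

@[simp] lemma coeff_powHom (x : A) (f : PowerSeries ℂ) (m : ℕ) :
    coeff m (powHom x f) = coeff m f • x ^ m := by
  change coeff m (PowerSeries.mk fun m => coeff m f • x ^ m) = _
  rw [PowerSeries.coeff_mk]

/-- The rescaling `h ↦ a h` of the variable by a scalar. -/
def scaleHom (a : ℂ) : PowerSeries A →+* PowerSeries A where
  toFun f := PowerSeries.mk fun m => a ^ m • coeff m f
  map_zero' := by ext; simp
  map_one' := by
    ext m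
    by_cases h : m = 0 <;> simp [PowerSeries.coeff_one, h]
  map_add' f g := by ext; simp
  map_mul' f g := by
    ext m
    simp only [PowerSeries.coeff_mk, PowerSeries.coeff_mul, Finset.smul_sum]
    refine Finset.sum_congr rfl fun p hp => ?_
    rw [smul_mul_smul_comm, ← pow_add, Finset.HasAntidiagonal.mem_antidiagonal.mp hp]

@[simp] lemma coeff_scaleHom (a : ℂ) (f : PowerSeries A) (m : ℕ) :
    coeff m (scaleHom a f) = a ^ m • coeff m f := by
  change coeff m (PowerSeries.mk fun m => a ^ m • coeff m f) = _
  rw [PowerSeries.coeff_mk]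

lemma scaleHom_scaleHom (a b : ℂ) (f : PowerSeries A) :
    scaleHom a (scaleHom b f) = scaleHom (a * b) f := by
  ext m; simp [smul_smul, mul_pow]

lemma scaleHom_one (f : PowerSeries A) : scaleHom 1 f = f := by
  ext m; simp

lemma scaleHom_X_pow_mul (a : ℂ) (N : ℕ) (f : PowerSeries A) :
    scaleHom a (PowerSeries.X ^ N * f) = PowerSeries.X ^ N * (a ^ N • scaleHom a f) := by
  ext m
  by_cases h : N ≤ m
  · obtain ⟨d, rfl⟩ := Nat.exists_eq_add_of_le' h
    simp [-map_mul, PowerSeries.coeff_X_pow_mul, smul_smul, pow_add, mul_comm]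
  · simp [-map_mul, PowerSeries.coeff_X_pow_mul', h]

/-- The series `exp(a h x)`. -/
def expSeries (x : A) (a : ℂ) : PowerSeries A :=
  powHom x (PowerSeries.rescale a (PowerSeries.exp ℂ))

@[simp] lemma coeff_expSeries (x : A) (a : ℂ) (m : ℕ) :
    coeff m (expSeries x a) = (a ^ m * (m.factorial : ℂ)⁻¹) • x ^ m := by
  simp [expSeries, PowerSeries.coeff_exp]

lemma expSeries_mul (x : A) (a b : ℂ) :
    expSeries x a * expSeries x b = expSeries x (a + b) := by
  rw [expSeries, expSeries, expSeries, ← map_mul, PowerSeries.exp_mul_exp_eq_exp_add]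

lemma expSeries_zero (x : A) : expSeries x 0 = 1 := by
  ext m
  by_cases h : m = 0 <;> simp [PowerSeries.coeff_one, h]

lemma scaleHom_expSeries (x : A) (a b : ℂ) :
    scaleHom a (expSeries x b) = expSeries x (a * b) := by
  ext m; simp [smul_smul, mul_pow, mul_assoc]

/-- `R = exp(a h x) + h ^ N (g₀ + g₁ h + g₂ h² + ⋯)`. -/
def IsPerturbed (N : ℕ) (x : A) (a : ℂ) (R : PowerSeries A) (g₀ g₁ g₂ : A) : Prop :=
  ∃ G, R = expSeries x a + PowerSeries.X ^ N * G ∧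
    coeff 0 G = g₀ ∧ coeff 1 G = g₁ ∧ coeff 2 G = g₂

/-- Only terms linear in the perturbations matter: their product carries h^(2N), and N ≥ 3 puts it
beyond h^(N+2). -/
lemma IsPerturbed.mul {N : ℕ} (hN : 3 ≤ N) {x : A} {a b : ℂ} {R S : PowerSeries A}
    {g₀ g₁ g₂ k₀ k₁ k₂ : A} (hR : IsPerturbed N x a R g₀ g₁ g₂)
    (hS : IsPerturbed N x b S k₀ k₁ k₂) :
    IsPerturbed N x (a + b) (R * S) (k₀ + g₀)
      (k₁ + a • (x * k₀) + (g₁ + b • (g₀ * x)))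
      (k₂ + a • (x * k₁) + (a ^ 2 / 2) • (x ^ 2 * k₀) +
        (g₂ + b • (g₁ * x) + (b ^ 2 / 2) • (g₀ * x ^ 2))) := by
  obtain ⟨G, rfl, hg0, hg1, hg2⟩ := hR
  obtain ⟨K, rfl, hk0, hk1, hk2⟩ := hS
  refine ⟨expSeries x a * K + G * expSeries x b + PowerSeries.X ^ N * (G * K), ?_, ?_, ?_, ?_⟩
  · rw [add_mul, mul_add, mul_add, expSeries_mul, mul_add, mul_add]
    -- Powers of h are central, so every h^N can be moved to the left.
    rw [← mul_assoc (expSeries x a), ← PowerSeries.X_pow_mul (φ := expSeries x a),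
      ← mul_assoc (PowerSeries.X ^ N * G) (PowerSeries.X ^ N) K,
      mul_assoc (PowerSeries.X ^ N) G (PowerSeries.X ^ N), ← PowerSeries.X_pow_mul (φ := G)]
    simp only [mul_assoc, add_assoc]
  all_goals
    simp only [map_add, coeff_zero_mul', coeff_one_mul', coeff_two_mul',
      PowerSeries.coeff_X_pow, hg0, hg1, hg2, hk0, hk1, hk2, coeff_expSeries]
    simp [show 1 ≠ N by omega, show 2 ≠ N by omega,
      show 0 ≠ N by omega, div_eq_mul_inv]
    try abel

end Algebra

/-! ### Formal exponential and logarithm of perturbed series -/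

section Algebra

open PowerSeries (coeff)

/-- The coefficients of `h ^ N`, `h ^ (N + 1)`, `h ^ (N + 2)` in `(u + h ^ N D) ^ k - u ^ k`. -/
lemma add_X_pow_mul_pow {A : Type*} [Ring A] {N : ℕ} (hN : 3 ≤ N) {u D : PowerSeries A} {x y : A}
    (h0 : coeff 0 u = 0) (h1 : coeff 1 u = x) (h2 : coeff 2 u = y) (k : ℕ) :
    ∃ F, (u + PowerSeries.X ^ N * D) ^ k = u ^ k + PowerSeries.X ^ N * F ∧
      coeff 0 F = (if k = 1 then coeff 0 D else 0) ∧
      coeff 1 F = (if k = 1 then coeff 1 D else if k = 2 then x * coeff 0 D + coeff 0 D * x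
        else 0) ∧
      coeff 2 F = (if k = 1 then coeff 2 D else if k = 2 then x * coeff 1 D + coeff 1 D * x +
          (y * coeff 0 D + coeff 0 D * y)
        else if k = 3 then x * x * coeff 0 D + x * coeff 0 D * x + coeff 0 D * x * x else 0) := by
  have hu (k : ℕ) : coeff 0 (u ^ k) = (if k = 0 then 1 else 0) ∧
      coeff 1 (u ^ k) = (if k = 1 then x else 0) ∧
      coeff 2 (u ^ k) = (if k = 1 then y else if k = 2 then x * x else 0) := by
    induction k with
    | zero => simp [PowerSeries.coeff_one]
    | succ k ih =>
      obtain ⟨i0, i1, i2⟩ := ih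
      rw [pow_succ, coeff_zero_mul', coeff_one_mul', coeff_two_mul', i0, i1, i2, h0, h1, h2]
      rcases k with _ | _ | k <;> simp
  induction k with
  | zero => exact ⟨0, by simp⟩
  | succ k ih =>
    obtain ⟨u0, u1, u2⟩ := hu k
    obtain ⟨F, hF, f0, f1, f2⟩ := ih
    refine ⟨u ^ k * D + F * u + PowerSeries.X ^ N * (F * D), ?_, ?_, ?_, ?_⟩
    · rw [pow_succ, hF, add_mul, mul_add, mul_add, ← pow_succ, mul_add, mul_add]
      rw [← mul_assoc (u ^ k), ← PowerSeries.X_pow_mul (φ := u ^ k),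
        ← mul_assoc (PowerSeries.X ^ N * F) (PowerSeries.X ^ N) D,
        mul_assoc (PowerSeries.X ^ N) F (PowerSeries.X ^ N), ← PowerSeries.X_pow_mul (φ := F)]
      simp only [mul_assoc, add_assoc]
    all_goals
      simp only [map_add, coeff_zero_mul', coeff_one_mul', coeff_two_mul',
        PowerSeries.coeff_X_pow, u0, u1, u2, f0, f1, f2, h0, h1, h2]
      rcases k with _ | _ | _ | k <;>
      simp [show 1 ≠ N by omega, show 2 ≠ N by omega, show 0 ≠ N by omega, add_mul] <;>
      try abel

/-- `log (exp h) = h`, coefficient by coefficient. -/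
lemma sum_log_exp (m : ℕ) :
    ∑ k ∈ Finset.Icc 1 m, ((-1 : ℂ) ^ (k + 1) / (k : ℂ)) *
      coeff m ((PowerSeries.exp ℂ - 1) ^ k) = if m = 1 then 1 else 0 := by
  rcases m with _ | m
  · simp
  set u : PowerSeries ℂ := PowerSeries.exp ℂ - 1 with hu
  have hX : (PowerSeries.X : PowerSeries ℂ) ∣ u := by
    rw [PowerSeries.X_dvd_iff]; simp [hu]
  have hd : PowerSeries.derivative ℂ u = 1 + u := by
    simp [hu, PowerSeries.derivative_exp]
  -- A partial sum of log(1+u). As u' = 1+u, its derivative is a telescoping geometric sum, and the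
  -- leftover (-u)^(m+1) is invisible at h^m because h divides u.
  set f : PowerSeries ℂ := ∑ k ∈ Finset.range (m + 1),
    PowerSeries.C ((-1 : ℂ) ^ k / ((k : ℂ) + 1)) * u ^ (k + 1) with hf
  have hdf : PowerSeries.derivative ℂ f = 1 - (-u) ^ (m + 1) := by
    rw [hf, map_sum, ← mul_neg_geom_sum, Finset.mul_sum]
    refine Finset.sum_congr rfl fun k _ => ?_
    rw [Derivation.leibniz, PowerSeries.derivative_pow, hd, PowerSeries.derivative_C]
    have : (PowerSeries.C ((-1 : ℂ) ^ k / ((k : ℂ) + 1)) : PowerSeries ℂ) * ((k + 1 : ℕ) : _) =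
        (-1) ^ k := by
      rw [← map_natCast (PowerSeries.C (R := ℂ)), ← map_mul]
      have : (k : ℂ) + 1 ≠ 0 := by exact_mod_cast k.succ_ne_zero
      push_cast
      rw [div_mul_cancel₀ _ this]
      simp
    simp only [smul_eq_mul, Nat.add_sub_cancel, mul_zero, add_zero]
    rw [← mul_assoc, ← mul_assoc, this, neg_pow u]
    ring
  have hc := congrArg (coeff m) hdf
  have hz : coeff m ((-u) ^ (m + 1)) = 0 :=
    PowerSeries.X_pow_dvd_iff.mp (pow_dvd_pow_of_dvd
      ((dvd_neg (α := PowerSeries ℂ)).mpr hX) (m + 1)) m (Nat.lt_succ_self m)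
  rw [PowerSeries.coeff_derivative, map_sub, hz, sub_zero, PowerSeries.coeff_one] at hc
  have hs : ∑ k ∈ Finset.Icc 1 (m + 1), ((-1 : ℂ) ^ (k + 1) / (k : ℂ)) * coeff (m + 1) (u ^ k) =
      coeff (m + 1) f := by
    rw [hf, map_sum, Finset.range_eq_Ico,
      show Finset.Icc 1 (m + 1) = Finset.Ico (0 + 1) (m + 1 + 1) by ext; simp,
      ← Finset.sum_Ico_add' (fun k : ℕ =>
      ((-1 : ℂ) ^ (k + 1) / (k : ℂ)) * coeff (m + 1) (u ^ k)) 0 (m + 1) 1]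
    refine Finset.sum_congr rfl fun k _ => ?_
    rw [PowerSeries.coeff_C_mul, pow_add, pow_add]
    push_cast
    ring
  rw [hs]
  rcases m with _ | m
  · simpa using hc
  · have : ((m + 1 : ℕ) : ℂ) + 1 ≠ 0 := by exact_mod_cast (m + 1).succ_ne_zero
    have hc' := (mul_eq_zero.mp (hc.trans (if_neg m.succ_ne_zero))).resolve_right this
    rw [hc', if_neg (by omega)]

lemma formalLog_expSeries (x : FreeAlgebra ℂ ℕ) (m : ℕ) :
    coeff m (formalLog (expSeries x 1)) = if m = 1 then x else 0 := by
  have h : expSeries x 1 - 1 = powHom x (PowerSeries.exp ℂ - 1) := by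
    rw [map_sub, map_one, expSeries, PowerSeries.rescale_one, RingHom.id_apply]
  have := sum_log_exp m
  rw [formalLog, PowerSeries.coeff_mk, h]
  simp only [← map_pow, coeff_powHom, smul_smul, ← Finset.sum_smul, this]
  split_ifs with h1 <;> simp [h1]

lemma sum_eq_sum_range_four {M : Type*} [AddCommMonoid M] {K : ℕ} (hK : 3 < K) {f : ℕ → M}
    (hf : ∀ k, 3 < k → f k = 0) :
    ∑ k ∈ Finset.range K, f k = f 0 + f 1 + f 2 + f 3 := by
  rw [← Finset.sum_subset (Finset.range_mono (show 4 ≤ K by omega))]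
  · simp [Finset.sum_range_succ]
  · intro k _ hk
    exact hf k (by simp at hk; omega)

/-- The exponent is a h Y₁ plus a perturbation starting at h^(2n+1), without a term at h^(2n+2).
Through h^(2n+3) only its first, second and third powers contribute perturbation terms. -/
lemma isPerturbed_formalExp {n : ℕ} (hn : 1 ≤ n) (a : ℂ) :
    IsPerturbed (2 * n + 1) (Y 1) a (formalExp (basicExponent n a))
      (a ^ (2 * n + 1) • Y (2 * n + 1))
      ((a ^ (2 * n + 2) / 2) • (Y 1 * Y (2 * n + 1) + Y (2 * n + 1) * Y 1))
      (a ^ (2 * n + 3) • (Y (2 * n + 3) + (6⁻¹ : ℂ) • (Y 1 * Y 1 * Y (2 * n + 1) +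
        Y 1 * Y (2 * n + 1) * Y 1 + Y (2 * n + 1) * Y 1 * Y 1))) := by
  set u : OpSeries := powHom (Y 1) (PowerSeries.C a * PowerSeries.X) with hu
  have cu (m : ℕ) : coeff m u = if m = 1 then a • Y 1 else 0 := by
    rw [hu, coeff_powHom, PowerSeries.coeff_C_mul, PowerSeries.coeff_X]
    split_ifs with h <;> simp [h]
  obtain ⟨D, hD, cD⟩ := exists_eq_add_X_pow_mul (R := basicExponent n a) (E := u)
    (N := 2 * n + 1) (fun k hk => by
      rw [cu, basicExponent, PowerSeries.coeff_mk]
      by_cases h : k = 1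
      · simp [h]
      · simp [h, show ¬ 2 * n + 1 ≤ k by omega])
  have cD' (j : ℕ) : coeff j D = if Odd (j + (2 * n + 1)) then a ^ (j + (2 * n + 1)) •
      Y (j + (2 * n + 1)) else 0 := by
    rw [cD, cu, basicExponent, PowerSeries.coeff_mk]
    simp [show ¬ j + (2 * n + 1) = 1 by omega]
  have d0 : coeff 0 D = a ^ (2 * n + 1) • Y (2 * n + 1) := by
    rw [cD', if_pos (by simp), zero_add]
  have d1 : coeff 1 D = 0 := by
    rw [cD', if_neg (by rw [Nat.not_odd_iff_even]; exact ⟨n + 1, by ring⟩)]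
  have d2 : coeff 2 D = a ^ (2 * n + 3) • Y (2 * n + 3) := by
    rw [cD', if_pos ⟨n + 1, by ring⟩, show 2 + (2 * n + 1) = 2 * n + 3 by ring]
  choose F hF f0 f1 f2 using fun k => add_X_pow_mul_pow (show 3 ≤ 2 * n + 1 by omega)
    (D := D) (cu 0) (cu 1) (cu 2) k
  have hE (m : ℕ) : ∑ k ∈ Finset.range (m + 1), ((k.factorial : ℂ)⁻¹) • coeff m (u ^ k) =
      coeff m (expSeries (Y 1) a) := by
    rw [coeff_expSeries, Finset.sum_eq_single_of_mem m (by simp)]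
    · rw [hu, ← map_pow, coeff_powHom, mul_pow, ← map_pow, PowerSeries.coeff_C_mul,
        PowerSeries.coeff_X_pow_self, smul_smul]
      congr 1; ring
    · intro k _ hk
      rw [hu, ← map_pow, coeff_powHom, mul_pow, ← map_pow, PowerSeries.coeff_C_mul,
        PowerSeries.coeff_X_pow, if_neg (Ne.symm hk)]
      simp
  have hR (m : ℕ) : coeff m (formalExp (basicExponent n a)) = coeff m (expSeries (Y 1) a) +
      ∑ k ∈ Finset.range (m + 1), ((k.factorial : ℂ)⁻¹) •
        coeff m (PowerSeries.X ^ (2 * n + 1) * F k) := by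
    rw [formalExp, PowerSeries.coeff_mk, ← hE, ← Finset.sum_add_distrib]
    refine Finset.sum_congr rfl fun k _ => ?_
    rw [hD, hF, map_add, smul_add]
  obtain ⟨G, hG, cG⟩ := exists_eq_add_X_pow_mul (R := formalExp (basicExponent n a))
    (E := expSeries (Y 1) a) (N := 2 * n + 1) (fun k hk => by
      rw [hR]
      simp [PowerSeries.coeff_X_pow_mul', show ¬ 2 * n + 1 ≤ k by omega])
  have cG' (j : ℕ) : coeff j G = ∑ k ∈ Finset.range (j + (2 * n + 1) + 1),
      ((k.factorial : ℂ)⁻¹) • coeff j (F k) := by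
    rw [cG, hR, add_sub_cancel_left]
    simp only [PowerSeries.coeff_X_pow_mul]
  refine ⟨G, hG, ?_, ?_, ?_⟩ <;>
  · rw [cG', sum_eq_sum_range_four (by omega)
      (fun k hk => by simp [f0, f1, f2, show k ≠ 1 by omega, show k ≠ 2 by omega,
        show k ≠ 3 by omega])]
    simp [f0, f1, f2, d0, d1, d2, Nat.factorial, smul_smul, mul_assoc]
    try module

/-- The logarithm of a perturbed exponential. -/
lemma coeff_formalLog {N : ℕ} (hN : 3 ≤ N) {x g₁ g₂ : FreeAlgebra ℂ ℕ} {R : OpSeries}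
    (hR : IsPerturbed N x 1 R 0 g₁ g₂) (j : ℕ) (hj : j ≤ N + 2) :
    coeff j (formalLog R) = if j = 1 then x else if j = N + 1 then g₁ else if j = N + 2 then
      g₂ - (2⁻¹ : ℂ) • (x * g₁ + g₁ * x) else 0 := by
  obtain ⟨G, rfl, rfl0, hg1, hg2⟩ := hR
  set u := expSeries x 1 - 1 with hu
  have c0 : coeff 0 u = 0 := by rw [hu, map_sub, coeff_expSeries]; simp
  have c1 : coeff 1 u = x := by rw [hu, map_sub, coeff_expSeries]; simp [PowerSeries.coeff_one]
  choose F hF f0 f1 f2 using fun k => add_X_pow_mul_pow hN (D := G) c0 c1 rfl k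
  have hlog (m : ℕ) : coeff m (formalLog (expSeries x 1 + PowerSeries.X ^ N * G)) =
      (if m = 1 then x else 0) + ∑ k ∈ Finset.Icc 1 m, ((-1 : ℂ) ^ (k + 1) / (k : ℂ)) •
        coeff m (PowerSeries.X ^ N * F k) := by
    rw [← formalLog_expSeries, formalLog, formalLog, PowerSeries.coeff_mk, PowerSeries.coeff_mk,
      ← Finset.sum_add_distrib]
    refine Finset.sum_congr rfl fun k _ => ?_
    rw [add_sub_right_comm, ← hu, hF, map_add, smul_add]
  rw [hlog]
  by_cases hjN : j < N
  · simp [PowerSeries.coeff_X_pow_mul', show ¬ N ≤ j by omega, show ¬ j = N + 1 by omega,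
      show ¬ j = N + 2 by omega]
  obtain ⟨i, rfl⟩ := Nat.exists_eq_add_of_le' (not_lt.mp hjN)
  have hs : ∑ k ∈ Finset.Icc 1 (i + N), ((-1 : ℂ) ^ (k + 1) / (k : ℂ)) •
        coeff (i + N) (PowerSeries.X ^ N * F k) =
      ∑ k ∈ Finset.range (i + N + 1), ((-1 : ℂ) ^ (k + 1) / (k : ℂ)) • coeff i (F k) := by
    simp only [PowerSeries.coeff_X_pow_mul]
    refine Finset.sum_subset (fun k hk => ?_) (fun k hk hk' => ?_)
    · simp only [Finset.mem_Icc] at hk; simp; omega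
    · simp only [Finset.mem_Icc, Finset.mem_range] at hk hk'
      -- The added term k = 0 is zero because division by zero yields zero.
      simp [show k = 0 by omega]
  have hi : i ≤ 2 := by omega
  rw [hs, sum_eq_sum_range_four (by omega)
      (fun k hk => by interval_cases i <;> simp [f0, f1, f2, show k ≠ 1 by omega,
        show k ≠ 2 by omega, show k ≠ 3 by omega])]
  rw [if_neg (show i + N ≠ 1 by omega), if_neg (show i + N ≠ 1 by omega)]
  interval_cases i
  · simp [f0, rfl0]
  · simp [f1, hg1, rfl0, add_comm 1 N]
  · simp [f2, hg1, hg2, rfl0, add_comm 2 N]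
    norm_num
    module

end Algebra

/-! ### Cancellations in compositions and averages of symmetric series -/

section Algebra

open PowerSeries (coeff)

lemma X_pow_mul_mul_X_pow_mul {A : Type*} [Ring A] (m : ℕ) (f g : PowerSeries A) :
    PowerSeries.X ^ m * f * (PowerSeries.X ^ m * g) = PowerSeries.X ^ (2 * m) * (f * g) := by
  rw [mul_assoc, ← mul_assoc f, ← PowerSeries.X_pow_mul (φ := f), two_mul, pow_add]
  simp only [mul_assoc]

variable {A : Type*} [Ring A] [Algebra ℂ A]

/-- Composition of two steps whose leading error terms cancel. -/
lemma exists_isPerturbed_pair {N : ℕ} (hN : 3 ≤ N) {x Z W : A} {R : ℂ → PowerSeries A}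
    (hR : ∀ a, IsPerturbed N x a (R a) (a ^ N • Z) ((a ^ (N + 1) / 2) • (x * Z + Z * x))
      (a ^ (N + 2) • W)) {g k : ℂ} (hgk : g + k = 1) (hw : g ^ N + k ^ N = 0) :
    ∃ W' : A, ∀ u : ℂ, IsPerturbed N x u (R (u * k) * R (u * g)) 0
      ((u ^ (N + 1) * (g ^ N / 2)) • ⁅x, Z⁆) (u ^ (N + 2) • W') := by
  -- This is the h^(N+2) coefficient of the product at u = 1; by homogeneity u enters only through
  -- the factor u^(N+2).
  refine ⟨g ^ (N + 2) • W + k • (x * ((g ^ (N + 1) / 2) • (x * Z + Z * x))) +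
    (k ^ 2 / 2) • (x ^ 2 * (g ^ N • Z)) + (k ^ (N + 2) • W +
      g • (((k ^ (N + 1) / 2) • (x * Z + Z * x)) * x) + (g ^ 2 / 2) • ((k ^ N • Z) * x ^ 2)),
    fun u => ?_⟩
  have h := (hR (u * k)).mul hN (hR (u * g))
  have hk : k ^ N = - g ^ N := by linear_combination hw
  obtain rfl : g = 1 - k := by linear_combination hgk
  have e0 : (u * (1 - k)) ^ N • Z + (u * k) ^ N • Z = 0 := by
    rw [← add_smul, mul_pow, mul_pow, ← mul_add, hw, mul_zero, zero_smul]
  have e1 : u * k + u * (1 - k) = u := by ring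
  rw [e0, e1] at h
  convert h using 1
  · simp only [mul_smul_comm, smul_mul_assoc, smul_add, smul_smul, Ring.lie_def, mul_pow]
    match_scalars
    · simp only [pow_succ, hk]; ring
    · simp only [pow_succ, hk]; ring
  · simp only [mul_smul_comm, smul_mul_assoc, smul_add, smul_smul, mul_pow, mul_add, add_mul]
    module

/-- The composition with coefficients `p g, p k, q g, q k`. -/
lemma isPerturbed_quad {N : ℕ} (hN : 3 ≤ N) {x Z W : A} {R : ℂ → PowerSeries A}
    (hR : ∀ a, IsPerturbed N x a (R a) (a ^ N • Z) ((a ^ (N + 1) / 2) • (x * Z + Z * x))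
      (a ^ (N + 2) • W)) {p q g k : ℂ} (hpq : p + q = 1) (hgk : g + k = 1)
    (hw : g ^ N + k ^ N = 0) (hv : p ^ (N + 2) + q ^ (N + 2) = 0) :
    IsPerturbed N x 1 (([p * g, p * k, q * g, q * k].map R).reverse.prod) 0
      ((g ^ N / 2 * (p ^ (N + 1) + q ^ (N + 1))) • ⁅x, Z⁆)
      ((g ^ N / 4 * (p * q * (p ^ N - q ^ N))) • ⁅x, ⁅x, Z⁆⁆ +
        (g ^ N / 4 * (p ^ (N + 1) + q ^ (N + 1))) • (x * ⁅x, Z⁆ + ⁅x, Z⁆ * x)) := by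
  obtain ⟨W', hW⟩ := exists_isPerturbed_pair hN hR hgk hw
  have h := (hW q).mul hN (hW p)
  rw [add_comm q p, hpq] at h
  convert h using 1
  · simp [mul_assoc]
  · simp
  · simp only [mul_zero, smul_zero, zero_mul, add_zero]
    module
  · obtain rfl : q = 1 - p := by linear_combination hpq
    simp only [mul_zero, smul_zero, zero_mul, add_zero]
    rw [Ring.lie_def x ⁅x, Z⁆]
    generalize ⁅x, Z⁆ = B
    simp only [mul_smul_comm, smul_mul_assoc, smul_add, smul_smul]
    match_scalars
    · linear_combination (g ^ N / 4) * hv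
    · linear_combination (g ^ N / 4) * hv
    · linear_combination -hv

/-- The leading coefficients of a time-symmetric series that agrees with `exp(h x)` below `h ^ N`,
`N` odd. -/
lemma isPerturbed_scaleHom {N : ℕ} (hN : 3 ≤ N) (hodd : Odd N) {x : A} {P : PowerSeries A}
    (hP : ∀ k < N, coeff k P = coeff k (expSeries x 1)) (hsym : scaleHom (-1) P * P = 1) :
    ∃ Z W : A, ∀ a, IsPerturbed N x a (scaleHom a P) (a ^ N • Z)
      ((a ^ (N + 1) / 2) • (x * Z + Z * x)) (a ^ (N + 2) • W) := by
  obtain ⟨G, hG, -⟩ := exists_eq_add_X_pow_mul hP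
  have hS (a : ℂ) : IsPerturbed N x a (scaleHom a P) (a ^ N • coeff 0 G) (a ^ (N + 1) • coeff 1 G)
      (a ^ (N + 2) • coeff 2 G) := by
    refine ⟨a ^ N • scaleHom a G, ?_, ?_, ?_, ?_⟩
    · rw [hG, map_add, scaleHom_expSeries, mul_one, scaleHom_X_pow_mul]
    all_goals simp [smul_smul, pow_add, -PowerSeries.coeff_zero_eq_constantCoeff]
  -- In P(-h)P(h) = 1 the coefficient of h^(N+1) must vanish; with the signs for N odd this
  -- determines `coeff 1 G` from `coeff 0 G`.
  have h1 := (hS (-1)).mul hN (hS 1)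
  rw [scaleHom_one, hsym, neg_add_cancel] at h1
  obtain ⟨K, hK, -, hK1, -⟩ := h1
  have hK0 : coeff 1 K = 0 := by
    rw [expSeries_zero, left_eq_add] at hK
    have := congrArg (coeff (1 + N)) hK
    rwa [PowerSeries.coeff_X_pow_mul, map_zero] at this
  rw [hK1] at hK0
  simp only [one_pow, one_smul, hodd.neg_one_pow, hodd.add_one.neg_one_pow, neg_smul,
    neg_mul] at hK0
  have hc : coeff 1 G = (2⁻¹ : ℂ) • (x * coeff 0 G + coeff 0 G * x) := by
    have h2 : coeff 1 G + coeff 1 G = x * coeff 0 G + coeff 0 G * x := by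
      rw [← sub_eq_zero, ← hK0]; abel
    rw [← h2, ← two_smul ℂ, smul_smul]; norm_num
  refine ⟨coeff 0 G, coeff 2 G, fun a => ?_⟩
  convert hS a using 1
  rw [hc, smul_smul, div_eq_mul_inv]

/-- The product telescopes from its middle, each adjacent pair being a rescaling of P(-h)P(h) = 1.
It identifies the reversed list with the adjoint composition. -/
lemma scaleHom_neg_one_mul_reverse (P : PowerSeries A) (hsym : scaleHom (-1) P * P = 1)
    (l : List ℂ) :
    scaleHom (-1) ((l.map fun a => scaleHom a P).reverse.prod) *
      (l.map fun a => scaleHom a P).prod = 1 := by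
  induction l with
  | nil => simp
  | cons a l ih =>
    have h (a : ℂ) : scaleHom (-1) (scaleHom a P) * scaleHom a P = 1 := by
      rw [scaleHom_scaleHom, mul_comm, ← scaleHom_scaleHom, ← map_mul, hsym, map_one]
    simp only [List.map_cons, List.reverse_cons, List.prod_append, List.prod_cons, List.prod_nil,
      mul_one, map_mul]
    rw [mul_assoc, ← mul_assoc (scaleHom (-1) (scaleHom a P)), h, one_mul, ih]

/-- The average of four mutually close series, closed under the adjoint, is symmetric up to twice
the order. -/
lemma average_symmetric {m : ℕ} {R : Fin 4 → PowerSeries A} {E : PowerSeries A}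
    (hE : ∀ i, ∃ H, R i = E + PowerSeries.X ^ m * H)
    (h02 : scaleHom (-1) (R 0) * R 2 = 1) (h20 : scaleHom (-1) (R 2) * R 0 = 1)
    (h13 : scaleHom (-1) (R 1) * R 3 = 1) (h31 : scaleHom (-1) (R 3) * R 1 = 1) :
    ∃ H, scaleHom (-1) ((1 / 4 : ℂ) • (R 0 + R 1 + R 2 + R 3)) *
      ((1 / 4 : ℂ) • (R 0 + R 1 + R 2 + R 3)) = 1 + PowerSeries.X ^ (2 * m) * H := by
  set S : Fin 4 → PowerSeries A := fun i => scaleHom (-1) (R i)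
  have hd (i j i' j' : Fin 4) : ∃ H, (S i - S j) * (R i' - R j') = PowerSeries.X ^ (2 * m) * H := by
    choose H hH using hE
    refine ⟨((-1 : ℂ) ^ m • scaleHom (-1) (H i - H j)) * (H i' - H j'), ?_⟩
    rw [← X_pow_mul_mul_X_pow_mul, ← scaleHom_X_pow_mul]
    simp only [S, hH, ← map_sub, mul_sub, add_sub_add_left_eq_sub]
  obtain ⟨K1, h1⟩ := hd 2 3 0 1
  obtain ⟨K2, h2⟩ := hd 2 0 0 2
  obtain ⟨K3, h3⟩ := hd 2 1 0 3
  obtain ⟨K4, h4⟩ := hd 3 0 1 2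
  obtain ⟨K5, h5⟩ := hd 3 1 1 3
  obtain ⟨K6, h6⟩ := hd 0 1 2 3
  have hs (f : PowerSeries A) : scaleHom (-1) ((1 / 4 : ℂ) • f) = (1 / 4 : ℂ) • scaleHom (-1) f := by
    ext; simp [smul_comm ((4 : ℂ)⁻¹)]
  -- Each of the six products of differences expands to 2 minus two of the twelve products S_i R_j
  -- not known to be 1. The four known ones therefore bring the sum of all sixteen to 16 - (K1 + ⋯ +
  -- K6) times h^(2m).
  refine ⟨(-(1 / 16) : ℂ) • (K1 + K2 + K3 + K4 + K5 + K6), ?_⟩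
  rw [hs, smul_mul_smul_comm, mul_smul_comm]
  simp only [mul_add, ← h1, ← h2, ← h3, ← h4, ← h5, ← h6, map_add]
  change _ • ((S 0 + S 1 + S 2 + S 3) * R 0 + (S 0 + S 1 + S 2 + S 3) * R 1 +
    (S 0 + S 1 + S 2 + S 3) * R 2 + (S 0 + S 1 + S 2 + S 3) * R 3) = _
  change S 0 * R 2 = 1 at h02
  change S 2 * R 0 = 1 at h20
  change S 1 * R 3 = 1 at h13
  change S 3 * R 1 = 1 at h31
  simp only [add_mul, sub_mul, mul_sub, h02, h20, h13, h31]
  module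

/-- A series symmetric to a high order has even order. -/
lemma coeff_eq_of_symmetric {r m : ℕ} (hr : Even r) (hr0 : 0 < r) (hrm : r < m) {x : A}
    {Q H : PowerSeries A}
    (hQ : ∀ k < r, coeff k Q = coeff k (expSeries x 1))
    (hsym : scaleHom (-1) Q * Q = 1 + PowerSeries.X ^ m * H) :
    ∀ k < r + 1, coeff k Q = coeff k (expSeries x 1) := by
  obtain ⟨G, hG, hG'⟩ := exists_eq_add_X_pow_mul hQ
  suffices h : coeff 0 G = 0 by
    intro k hk
    rcases Nat.lt_succ_iff_lt_or_eq.mp hk with hk | rfl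
    · exact hQ k hk
    · rw [hG', zero_add] at h
      exact sub_eq_zero.mp h
  have hs : scaleHom (-1) Q = expSeries x (-1) + PowerSeries.X ^ r * scaleHom (-1) G := by
    rw [hG, map_add, scaleHom_expSeries, scaleHom_X_pow_mul, hr.neg_one_pow, one_smul, mul_one]
  -- For r even both factors contribute the leading error `coeff 0 G` with the same sign, while the
  -- quadratic term and h^m H have higher degree. Hence twice that error is zero.
  have h1 := congrArg (coeff (0 + r)) hsym
  rw [hs, hG, add_mul, mul_add, mul_add, expSeries_mul, neg_add_cancel, expSeries_zero,
    X_pow_mul_mul_X_pow_mul, ← mul_assoc, ← PowerSeries.X_pow_mul (φ := expSeries x (-1)),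
    mul_assoc, mul_assoc] at h1
  simp only [map_add, PowerSeries.coeff_X_pow_mul] at h1
  rw [PowerSeries.coeff_X_pow_mul', PowerSeries.coeff_X_pow_mul', if_neg (by omega),
    if_neg (by omega), coeff_zero_mul', coeff_zero_mul'] at h1
  simp only [coeff_expSeries, coeff_scaleHom, pow_zero, Nat.factorial_zero, Nat.cast_one, inv_one,
    mul_one, one_smul, one_mul, add_zero, zero_add] at h1
  have h2 : coeff 0 G + coeff 0 G = 0 := by
    have := add_eq_left.mp ((add_assoc _ _ _).symm.trans h1)
    exact this
  rw [← two_smul ℂ] at h2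
  exact (smul_eq_zero_iff_right (two_ne_zero' ℂ)).mp h2

end Algebra

/-! ### The coefficients -/

/-- With t = π/(2(m+1)) the quotient in `gam` is tan t, so γ = (1 + i tan t)/2 = exp(it)/(2 cos t).
-/
lemma exists_gam_eq {m : ℕ} (hm : 1 ≤ m) : ∃ r : ℝ, 0 < r ∧
    gam m = (r : ℂ) * Complex.exp ((Real.pi / (2 * (m + 1)) : ℝ) * Complex.I) := by
  set t : ℝ := Real.pi / (2 * (m + 1)) with ht
  have hm0 : (0 : ℝ) < m := by exact_mod_cast hm
  have ht0 : 0 < t := by positivity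
  have ht1 : t < Real.pi / 2 := by
    rw [ht, div_lt_div_iff₀ (by positivity) two_pos]
    nlinarith [Real.pi_pos]
  have hc : 0 < Real.cos t := Real.cos_pos_of_mem_Ioo ⟨by linarith, ht1⟩
  refine ⟨(2 * Real.cos t)⁻¹, by positivity, ?_⟩
  have h2 : Real.pi / (m + 1) = 2 * t := by rw [ht]; field_simp
  have h3 : Real.sin (2 * t) / (1 + Real.cos (2 * t)) = Real.sin t / Real.cos t := by
    rw [Real.sin_two_mul, Real.cos_two_mul]
    field_simp
    ring
  rw [gam, h2, h3, Complex.exp_mul_I, ← Complex.ofReal_cos, ← Complex.ofReal_sin]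
  have hc' : (Real.cos t : ℂ) ≠ 0 := by exact_mod_cast hc.ne'
  push_cast [-Complex.ofReal_cos, -Complex.ofReal_sin]
  field_simp

lemma gam_add_conj (m : ℕ) : gam m + conj (gam m) = 1 := by
  rw [gam, Complex.add_conj]
  simp [← Complex.ofReal_ofNat, -Complex.ofReal_div, -Complex.ofReal_sin, -Complex.ofReal_cos,
    -Complex.ofReal_add]

lemma gam_pow_succ {m : ℕ} (hm : 1 ≤ m) : ∃ r : ℝ, 0 < r ∧ gam m ^ (m + 1) = r * Complex.I := by
  obtain ⟨r, hr, h⟩ := exists_gam_eq hm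
  refine ⟨r ^ (m + 1), by positivity, ?_⟩
  rw [h, mul_pow, ← Complex.exp_nat_mul, Complex.ofReal_pow]
  congr 1
  convert Complex.exp_pi_div_two_mul_I using 2
  have : ((m : ℂ) + 1) ≠ 0 := by exact_mod_cast m.succ_ne_zero
  push_cast
  field_simp

lemma gam_pow_succ_add_conj {m : ℕ} (hm : 1 ≤ m) :
    gam m ^ (m + 1) + conj (gam m) ^ (m + 1) = 0 := by
  obtain ⟨r, -, h⟩ := gam_pow_succ hm
  rw [← map_pow, h]
  simp

/-- The argument kπ/(2(m+1)) lies strictly between 0 and π. This yields the nonvanishing of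
μ_{2n+3,2}. -/
lemma gam_pow_im_pos {m k : ℕ} (hk : 1 ≤ k) (hkm : k ≤ m) : 0 < (gam m ^ k).im := by
  obtain ⟨r, hr, h⟩ := exists_gam_eq (hk.trans hkm)
  rw [h, mul_pow, ← Complex.exp_nat_mul, ← Complex.ofReal_pow,
    Complex.im_ofReal_mul, ← mul_assoc, ← Complex.ofReal_natCast, ← Complex.ofReal_mul,
    Complex.exp_ofReal_mul_I_im]
  have hk0 : (0 : ℝ) < k := by exact_mod_cast hk
  have hkm' : (k : ℝ) ≤ m := by exact_mod_cast hkm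
  refine mul_pos (by positivity) (Real.sin_pos_of_pos_of_lt_pi (by positivity) ?_)
  rw [mul_div_assoc', div_lt_iff₀ (by positivity)]
  nlinarith [Real.pi_pos]

lemma coeffs_spec (n : ℕ) :
    ∀ α ∈ [coeffs₁ n, coeffs₂ n, coeffs₃ n, coeffs₄ n],
      IsSymmetricConjugate α ∧ α.sum = 1 := by
  have h1 := gam_add_conj (2 * n + 2)
  have h2 := gam_add_conj (2 * n)
  generalize hp : conj (gam (2 * n + 2)) = q at h1
  generalize hg : conj (gam (2 * n)) = k at h2
  have h : (gam (2 * n + 2) + q) * (gam (2 * n) + k) = 1 := by rw [h1, h2, one_mul]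
  simp only [List.forall_mem_cons, List.not_mem_nil, IsSymmetricConjugate, coeffs₁, coeffs₂,
    coeffs₃, coeffs₄, hp, hg]
  refine ⟨⟨?_, ?_⟩, ⟨?_, ?_⟩, ⟨?_, ?_⟩, ⟨?_, ?_⟩, by simp⟩
  all_goals first
    | (simp only [← hp, ← hg]; simp; done)
    | (simp only [List.sum_cons, List.sum_nil]; linear_combination h)

lemma coeffs₃_eq (n : ℕ) : coeffs₃ n = (coeffs₁ n).map (fun a => conj a) := by
  simp [coeffs₁, coeffs₃]

lemma coeffs₄_eq (n : ℕ) : coeffs₄ n = (coeffs₂ n).map (fun a => conj a) := by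
  simp [coeffs₂, coeffs₄]

/-! ### The formal exponents -/

/-- The quadratic term of the logarithm subtracts half the symmetric product of x and the h^(2n+2)
coefficient; c₃ = c₁/2 makes this cancel exactly and leaves the double commutator. -/
lemma hasExpansion_of_isPerturbed {n : ℕ} (hn : 1 ≤ n) {α : List ℂ} {σ m : ℝ} {c₁ c₂ c₃ : ℂ}
    (hc₁ : c₁ = Complex.I * σ) (hc₂ : c₂ = m) (hc₃ : c₃ = c₁ / 2)
    (h : IsPerturbed (2 * n + 1) (Y 1) 1
      ((α.map fun a => formalExp (basicExponent n a)).reverse.prod) 0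
      (c₁ • ⁅Y 1, Y (2 * n + 1)⁆)
      (c₂ • ⁅Y 1, ⁅Y 1, Y (2 * n + 1)⁆⁆ +
        c₃ • (Y 1 * ⁅Y 1, Y (2 * n + 1)⁆ + ⁅Y 1, Y (2 * n + 1)⁆ * Y 1))) :
    HasExpansion n α 0 σ 0 m := by
  have H := coeff_formalLog (show 3 ≤ 2 * n + 1 by omega) h
  constructor
  · rw [exponent, H 0 (by omega)]; simp
  · rw [exponent, H 1 (by omega)]; simp
  · intro k h2 hk
    rw [exponent, H k (by omega), if_neg (by omega), if_neg (by omega), if_neg (by omega)]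
  · rw [exponent, H _ (by omega), if_neg (by omega), if_neg (by omega), if_neg (by omega)]
    simp
  · rw [exponent, H _ (by omega), if_neg (by omega), if_pos (by omega), hc₁]
  · rw [exponent, H _ (by omega), if_neg (by omega), if_neg (by omega), if_pos (by omega), hc₃, hc₂]
    simp only [mul_smul_comm, smul_mul_assoc]
    module

lemma exists_hasExpansion {n : ℕ} (hn : 1 ≤ n) :
    ∃ σ₁ σ₂ m : ℝ, m ≠ 0 ∧ HasExpansion n (coeffs₁ n) 0 σ₁ 0 m ∧
      HasExpansion n (coeffs₂ n) 0 σ₂ 0 (-m) := by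
  obtain ⟨r, hr, hw⟩ := gam_pow_succ (show 1 ≤ 2 * n by omega)
  have hR := fun a => isPerturbed_formalExp hn a
  have hw0 := gam_pow_succ_add_conj (show 1 ≤ 2 * n by omega)
  have hv0 := gam_pow_succ_add_conj (show 1 ≤ 2 * n + 2 by omega)
  have hg1 := gam_add_conj (2 * n)
  have hp1 := gam_add_conj (2 * n + 2)
  have him := gam_pow_im_pos (show 1 ≤ 2 * n + 1 by omega) (show 2 * n + 1 ≤ 2 * n + 2 by omega)
  have h1 := isPerturbed_quad (show 3 ≤ 2 * n + 1 by omega) hR hp1 hg1 hw0 hv0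
  have h2 := isPerturbed_quad (show 3 ≤ 2 * n + 1 by omega) hR hp1 ((add_comm _ _).trans hg1)
    ((add_comm _ _).trans hw0) hv0
  have hw' : conj (gam (2 * n)) ^ (2 * n + 1) = - (r * Complex.I) := by
    rw [← hw]; linear_combination hw0
  set p := gam (2 * n + 2) with hp
  set g := gam (2 * n) with hg
  have hp0 : p ≠ 0 := by
    intro h
    rw [h, zero_pow (by omega)] at him
    simp at him
  have e1 : p ^ (2 * n + 1 + 1) + conj p ^ (2 * n + 1 + 1) = (2 * (p ^ (2 * n + 2)).re : ℝ) := by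
    rw [← map_pow, Complex.add_conj]
  have e2 : p * conj p * (p ^ (2 * n + 1) - conj p ^ (2 * n + 1)) =
      (Complex.normSq p * (2 * (p ^ (2 * n + 1)).im) : ℝ) * Complex.I := by
    rw [← map_pow, Complex.sub_conj, Complex.mul_conj]
    push_cast; ring
  rw [e1, e2, hw] at h1
  rw [e1, e2, hw'] at h2
  -- Read off from `isPerturbed_quad` with g^N = r i and p^N - q^N = 2i Im(p^N); the product of the
  -- two factors i gives the minus sign in the third value.
  refine ⟨r * (p ^ (2 * n + 2)).re, -(r * (p ^ (2 * n + 2)).re),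
    -(r / 2 * (Complex.normSq p * (p ^ (2 * n + 1)).im)), ?_,
    hasExpansion_of_isPerturbed hn ?_ ?_ ?_ h1, hasExpansion_of_isPerturbed hn ?_ ?_ ?_ h2⟩
  · have := Complex.normSq_pos.mpr hp0
    exact neg_ne_zero.mpr (by positivity)
  · push_cast; ring
  · push_cast
    linear_combination (r * Complex.normSq p * (p ^ (2 * n + 1)).im / 2 : ℂ) * Complex.I_sq
  · ring
  · push_cast; ring
  · push_cast
    linear_combination (-r * Complex.normSq p * (p ^ (2 * n + 1)).im / 2 : ℂ) * Complex.I_sq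
  · ring

/-! ### Taylor expansions with parameters -/

section Taylor

/-- The mean value inequality on the closed ball of radius |h|, uniformly along the filter `l` of
parameters. -/
lemma isBigO_pow_succ_of_hasDerivAt {Y : Type*} {l : Filter Y} {R R' : ℂ × Y → ℂ} {K : ℕ}
    (hd : ∀ᶠ p in 𝓝 (0 : ℂ) ×ˢ l, HasDerivAt (fun h => R (h, p.2)) (R' p) p.1)
    (h0 : ∀ᶠ y in l, R (0, y) = 0) (hR' : R' =O[𝓝 (0 : ℂ) ×ˢ l] fun p => p.1 ^ K) :
    R =O[𝓝 (0 : ℂ) ×ˢ l] fun p => p.1 ^ (K + 1) := by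
  obtain ⟨C, hC⟩ := hR'.bound
  obtain ⟨pa, ha, pb, hb, hab⟩ := eventually_prod_iff.mp (hd.and hC)
  obtain ⟨ε, hε, hball⟩ := Metric.eventually_nhds_iff_ball.mp ha
  refine IsBigO.of_bound C ?_
  filter_upwards [(show ∀ᶠ h in 𝓝 (0 : ℂ), h ∈ Metric.ball (0 : ℂ) ε from
    Metric.ball_mem_nhds _ hε).prod_mk (hb.and h0)] with p hp
  obtain ⟨hp1, hp2, hp0⟩ := hp
  have hsub : ∀ z ∈ Metric.closedBall (0 : ℂ) ‖p.1‖, pa z := fun z hz =>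
    hball z (lt_of_le_of_lt (Metric.mem_closedBall.mp hz) (by simpa using hp1))
  have hCp : 0 ≤ C * ‖p.1‖ ^ K := by
    have := (hab (hball _ hp1) hp2).2
    rw [norm_pow] at this
    exact (norm_nonneg _).trans this
  have := Convex.norm_image_sub_le_of_norm_hasDerivWithin_le (f := fun h => R (h, p.2))
    (f' := fun h => R' (h, p.2)) (C := C * ‖p.1‖ ^ K) (s := Metric.closedBall (0 : ℂ) ‖p.1‖)
    (x := 0) (y := p.1) (fun z hz => (hab (hsub z hz) hp2).1.hasDerivWithinAt)
    (fun z hz => by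
      refine (hab (hsub z hz) hp2).2.trans ?_
      rw [norm_pow]
      rcases eq_or_ne p.1 0 with h | h
      · rw [h, norm_zero, Metric.closedBall_zero, Set.mem_singleton_iff] at hz
        rw [hz, h]
      · have hC0 : 0 ≤ C := nonneg_of_mul_nonneg_left hCp (by positivity)
        have : ‖z‖ ≤ ‖p.1‖ := by simpa using hz
        gcongr)
    (convex_closedBall _ _) (by simp) (by simp)
  rw [hp0, sub_zero, sub_zero] at this
  rw [norm_pow, pow_succ, ← mul_assoc]
  exact this

lemma hasDerivAt_sum_pow (c : ℕ → ℂ) (K : ℕ) (h : ℂ) :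
    HasDerivAt (fun h : ℂ => ∑ k ∈ Finset.range (K + 1), h ^ k * ((k.factorial : ℂ)⁻¹ * c k))
      (∑ k ∈ Finset.range K, h ^ k * ((k.factorial : ℂ)⁻¹ * c (k + 1))) h := by
  have := HasDerivAt.fun_sum (u := Finset.range (K + 1)) (fun k _ =>
    (hasDerivAt_pow k h).mul_const ((k.factorial : ℂ)⁻¹ * c k))
  refine this.congr_deriv ?_
  rw [Finset.sum_range_succ']
  rw [Nat.cast_zero, zero_mul, zero_mul, add_zero]
  refine Finset.sum_congr rfl fun k _ => ?_
  have : (k : ℂ) + 1 ≠ 0 := by exact_mod_cast k.succ_ne_zero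
  rw [Nat.factorial_succ]
  push_cast
  field_simp

lemma eq_zero_of_sum_pow_isBigO {K : ℕ} {c : ℕ → ℂ}
    (h : (fun z : ℂ => ∑ k ∈ Finset.range K, z ^ k * c k) =O[𝓝 0] fun z => z ^ K) :
    ∀ k < K, c k = 0 := by
  induction K with
  | zero => intro k hk; omega
  | succ K ih =>
    have hlow : (fun z : ℂ => z ^ (K + 1)) =o[𝓝 0] fun z => z ^ K :=
      isLittleO_pow_pow (Nat.lt_succ_self K)
    have hK : ∀ k < K, c k = 0 := by
      apply ih
      have h1 : (fun z : ℂ => z ^ K * c K) =O[𝓝 0] fun z => z ^ K := by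
        simpa [mul_comm] using (isBigO_refl (fun z : ℂ => z ^ K) (𝓝 0)).const_mul_left (c K)
      refine ((h.trans hlow.isBigO).sub h1).congr_left fun z => ?_
      rw [Finset.sum_range_succ, add_sub_cancel_right]
    intro k hk
    rcases Nat.lt_succ_iff_lt_or_eq.mp hk with hk | rfl
    · exact hK k hk
    by_contra hne
    have h2 : (fun z : ℂ => c k * z ^ k) =o[𝓝 0] fun z => z ^ k := by
      refine (h.trans_isLittleO hlow).congr_left fun z => ?_
      rw [Finset.sum_range_succ, Finset.sum_eq_zero (fun j hj => by
        rw [hK j (Finset.mem_range.mp hj), mul_zero]), zero_add, mul_comm]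
    have h3 := (isLittleO_const_mul_left_iff hne).mp h2
    refine isLittleO_irrefl' ?_ (h3.mono (nhdsWithin_le_nhds (s := {(0 : ℂ)}ᶜ)))
    refine Eventually.frequently ?_
    filter_upwards [self_mem_nhdsWithin] with z hz
    exact norm_ne_zero_iff.mpr (pow_ne_zero _ hz)

variable {E : Type*} [NormedAddCommGroup E] [NormedSpace ℂ E]

/-- The partial derivative with respect to the first variable. -/
def partialDeriv (F : ℂ × E → ℂ) (p : ℂ × E) : ℂ := fderiv ℂ F p (1, 0)

lemma analyticAt_partialDeriv {F : ℂ × E → ℂ} {p : ℂ × E} (hF : AnalyticAt ℂ F p) :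
    AnalyticAt ℂ (partialDeriv F) p :=
  ((ContinuousLinearMap.apply ℂ ℂ ((1, 0) : ℂ × E)).analyticAt _).comp hF.fderiv

lemma analyticAt_iterate_partialDeriv {F : ℂ × E → ℂ} {p : ℂ × E} (hF : AnalyticAt ℂ F p)
    (k : ℕ) : AnalyticAt ℂ (partialDeriv^[k] F) p := by
  induction k with
  | zero => exact hF
  | succ k ih => rw [Function.iterate_succ_apply']; exact analyticAt_partialDeriv ih

lemma hasDerivAt_partialDeriv {F : ℂ × E → ℂ} {p : ℂ × E} (hF : AnalyticAt ℂ F p) :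
    HasDerivAt (fun h => F (h, p.2)) (partialDeriv F p) p.1 :=
  HasFDerivAt.comp_hasDerivAt (f := fun h : ℂ => (h, p.2)) p.1
    hF.differentiableAt.hasFDerivAt ((hasDerivAt_id p.1).prodMk (hasDerivAt_const p.1 p.2))

lemma iterate_partialDeriv_add {F G : ℂ × E → ℂ} {p : ℂ × E} (hF : AnalyticAt ℂ F p)
    (hG : AnalyticAt ℂ G p) (k : ℕ) :
    partialDeriv^[k] (F + G) =ᶠ[𝓝 p] partialDeriv^[k] F + partialDeriv^[k] G := by
  induction k with
  | zero => rfl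
  | succ k ih =>
    simp only [Function.iterate_succ_apply']
    filter_upwards [ih.fderiv (𝕜 := ℂ), (analyticAt_iterate_partialDeriv hF k).eventually_analyticAt,
      (analyticAt_iterate_partialDeriv hG k).eventually_analyticAt] with q h1 h2 h3
    simp only [partialDeriv, Pi.add_apply]
    rw [h1, fderiv_add h2.differentiableAt h3.differentiableAt]
    rfl

lemma iterate_partialDeriv_smul {F : ℂ × E → ℂ} {p : ℂ × E} (hF : AnalyticAt ℂ F p) (c : ℂ)
    (k : ℕ) : partialDeriv^[k] (c • F) =ᶠ[𝓝 p] c • partialDeriv^[k] F := by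
  induction k with
  | zero => rfl
  | succ k ih =>
    simp only [Function.iterate_succ_apply']
    filter_upwards [ih.fderiv (𝕜 := ℂ), (analyticAt_iterate_partialDeriv hF k).eventually_analyticAt]
      with q h1 h2
    simp only [partialDeriv, Pi.smul_apply]
    rw [h1, fderiv_const_smul h2.differentiableAt]
    rfl

/-- Taylor expansion in the first variable, locally uniform in the second. -/
lemma taylor_isBigO {x : E} (K : ℕ) {F : ℂ × E → ℂ} (hF : AnalyticAt ℂ F (0, x)) :
    (fun p : ℂ × E => F p - ∑ k ∈ Finset.range K,
      p.1 ^ k * ((k.factorial : ℂ)⁻¹ * partialDeriv^[k] F (0, p.2))) =O[𝓝 (0, x)]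
      fun p => p.1 ^ K := by
  induction K generalizing F with
  | zero => simpa using hF.continuousAt.isBigO_one ℂ
  | succ K ih =>
    have h := ih (analyticAt_partialDeriv hF)
    rw [nhds_prod_eq] at h ⊢
    refine isBigO_pow_succ_of_hasDerivAt ?_ ?_ h
    · rw [← nhds_prod_eq]
      filter_upwards [hF.eventually_analyticAt] with p hp
      exact (hasDerivAt_partialDeriv hp).sub (hasDerivAt_sum_pow
        (fun k => partialDeriv^[k] F (0, p.2)) K p.1)
    · refine Eventually.of_forall fun y => ?_
      simp [Finset.sum_range_succ']

/-- First-order expansion with locally uniform quadratic remainder. -/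
lemma linearization_isBigO {x : E} {g : E → ℂ} (hg : AnalyticAt ℂ g x) :
    (fun q : E × E => g q.1 - g q.2 - fderiv ℂ g q.2 (q.1 - q.2)) =O[𝓝 (x, x)]
      fun q => ‖q.1 - q.2‖ ^ 2 := by
  obtain ⟨L, s, hs, hL⟩ := (hg.fderiv.contDiffAt (n := 1)).exists_lipschitzOnWith
  obtain ⟨ε, hε, hball⟩ := Metric.mem_nhds_iff.mp
    (inter_mem hs hg.eventually_analyticAt)
  refine IsBigO.of_bound L ?_
  filter_upwards [prod_mem_nhds (Metric.ball_mem_nhds x hε) (Metric.ball_mem_nhds x hε)]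
    with q hq
  have hseg : segment ℝ q.2 q.1 ⊆ Metric.ball x ε :=
    (convex_ball x ε).segment_subset hq.2 hq.1
  have := (convex_segment (𝕜 := ℝ) q.2 q.1).norm_image_sub_le_of_norm_hasFDerivWithin_le' (𝕜 := ℂ)
    (f := g) (f' := fderiv ℂ g) (φ := fderiv ℂ g q.2) (C := L * ‖q.1 - q.2‖) (x := q.2) (y := q.1)
    (fun z hz => ((hball (hseg hz)).2.differentiableAt.hasFDerivAt).hasFDerivWithinAt)
    (fun z hz => by
      refine (hL.norm_sub_le (hball (hseg hz)).1 (hball hq.2).1).trans ?_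
      gcongr
      obtain ⟨t, ht, rfl⟩ := (segment_eq_image' ℝ q.2 q.1).subset hz
      rw [add_sub_cancel_left, norm_smul, Real.norm_of_nonneg ht.1]
      exact mul_le_of_le_one_left (norm_nonneg _) ht.2)
    (left_mem_segment ℝ _ _) (right_mem_segment ℝ _ _)
  rw [Real.norm_of_nonneg (by positivity)]
  calc _ ≤ _ := this
    _ = _ := by ring

end Taylor

/-! ### Series of operators attached to a method -/

section Operators

open PowerSeries (coeff)

variable {d : ℕ} {U : Set (Fin d → ℂ)}

/-- The functions that are holomorphic on `U`, normalized to vanish off `U`. -/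
def holo (U : Set (Fin d → ℂ)) : Submodule ℂ ((Fin d → ℂ) → ℂ) where
  carrier := {g | AnalyticOnNhd ℂ g U ∧ ∀ x ∉ U, g x = 0}
  add_mem' {f g} hf hg := ⟨hf.1.add hg.1, fun x hx => by simp [hf.2 x hx, hg.2 x hx]⟩
  zero_mem' := ⟨analyticOnNhd_const, fun _ _ => rfl⟩
  smul_mem' c g hg := ⟨fun x hx => analyticAt_const.smul (hg.1 x hx),
    fun x hx => by simp [hg.2 x hx]⟩

lemma analyticAt_holo (g : holo U) {x : Fin d → ℂ} (hx : x ∈ U) :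
    AnalyticAt ℂ (g : (Fin d → ℂ) → ℂ) x := g.2.1 x hx

lemma holo_ext {f g : holo U} (h : ∀ x ∈ U, (f : (Fin d → ℂ) → ℂ) x = g.1 x) : f = g := by
  ext x
  by_cases hx : x ∈ U
  · exact h x hx
  · rw [f.2.2 x hx, g.2.2 x hx]

lemma indicator_mem_holo (hU : IsOpen U) {g : (Fin d → ℂ) → ℂ} (hg : AnalyticOnNhd ℂ g U) :
    U.indicator g ∈ holo U := by
  refine ⟨fun x hx => (hg x hx).congr ?_, fun x hx => Set.indicator_of_notMem hx g⟩
  filter_upwards [hU.mem_nhds hx] with y hy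
  rw [Set.indicator_of_mem hy]

/-- The coordinate functions. -/
def coord (hU : IsOpen U) (i : Fin d) : holo U :=
  ⟨U.indicator fun x => x i, indicator_mem_holo hU fun x _ =>
    (ContinuousLinearMap.proj (R := ℂ) (φ := fun _ : Fin d => ℂ) i).analyticAt x⟩

lemma coord_apply (hU : IsOpen U) (i : Fin d) {x : Fin d → ℂ} (hx : x ∈ U) :
    (coord hU i : (Fin d → ℂ) → ℂ) x = x i := by
  simp [coord, hx]

/-- `P` is the series of the operator `g ↦ g ∘ M_h` up to `O(h ^ K)`, locally uniformly on `U`. -/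
structure HasSeries (U : Set (Fin d → ℂ)) (K : ℕ) (M : ℂ → (Fin d → ℂ) → (Fin d → ℂ))
    (P : PowerSeries (Module.End ℂ (holo U))) : Prop where
  tendsto : ∀ x ∈ U, Tendsto (fun p : ℂ × (Fin d → ℂ) => M p.1 p.2) (𝓝 (0, x)) (𝓝 x)
  isBigO : ∀ x ∈ U, ∀ g : holo U, (fun p : ℂ × (Fin d → ℂ) => (g : (Fin d → ℂ) → ℂ) (M p.1 p.2) -
    ∑ k ∈ Finset.range K, p.1 ^ k * (coeff k P g : (Fin d → ℂ) → ℂ) p.2) =O[𝓝 (0, x)]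
      fun p => p.1 ^ K

lemma isBigO_one_of_holo (g : holo U) {x : Fin d → ℂ} (hx : x ∈ U) :
    (fun p : ℂ × (Fin d → ℂ) => (g : (Fin d → ℂ) → ℂ) p.2) =O[𝓝 (0, x)] fun _ => (1 : ℂ) :=
  ((analyticAt_holo g hx).continuousAt.tendsto.comp
    (continuous_snd.tendsto ((0 : ℂ), x))).isBigO_one ℂ

lemma isBigO_fst_pow {x : Fin d → ℂ} {j k : ℕ} (h : k ≤ j) :
    (fun p : ℂ × (Fin d → ℂ) => p.1 ^ j) =O[𝓝 (0, x)] fun p => p.1 ^ k := by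
  have h1 : (fun p : ℂ × (Fin d → ℂ) => p.1 ^ (j - k)) =O[𝓝 (0, x)] fun _ => (1 : ℂ) :=
    (show ContinuousAt (fun p : ℂ × (Fin d → ℂ) => p.1 ^ (j - k)) (0, x) by
      fun_prop).tendsto.isBigO_one ℂ
  have h2 := (isBigO_refl (fun p : ℂ × (Fin d → ℂ) => p.1 ^ k) (𝓝 (0, x))).mul h1
  simpa [← pow_add, Nat.add_sub_cancel' h] using h2

/-- Isolates the overflow, of degree at least K, that arises when two series truncated at K are
multiplied. -/
lemma sum_range_mul_antidiagonal {K : ℕ} {R : Type*} [CommRing R] (h : R) (c : ℕ × ℕ → R) :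
    ∑ p ∈ Finset.range K ×ˢ Finset.range K with ¬ p.1 + p.2 < K, h ^ (p.1 + p.2) * c p =
      ∑ k ∈ Finset.range K, h ^ k * ∑ l ∈ Finset.range K, h ^ l * c (k, l) -
      ∑ m ∈ Finset.range K, h ^ m * ∑ p ∈ Finset.HasAntidiagonal.antidiagonal m, c p := by
  have h1 : ∑ k ∈ Finset.range K, h ^ k * ∑ l ∈ Finset.range K, h ^ l * c (k, l) =
      ∑ p ∈ Finset.range K ×ˢ Finset.range K, h ^ (p.1 + p.2) * c p := by
    rw [Finset.sum_product]
    refine Finset.sum_congr rfl fun k _ => ?_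
    rw [Finset.mul_sum]
    refine Finset.sum_congr rfl fun l _ => ?_
    rw [pow_add, mul_assoc]
  have h2 : ∑ m ∈ Finset.range K, h ^ m * ∑ p ∈ Finset.HasAntidiagonal.antidiagonal m, c p =
      ∑ p ∈ Finset.range K ×ˢ Finset.range K with p.1 + p.2 < K, h ^ (p.1 + p.2) * c p := by
    rw [← Finset.sum_fiberwise_of_maps_to (t := Finset.range K) (g := fun p : ℕ × ℕ => p.1 + p.2)
      (fun p hp => by simpa using (Finset.mem_filter.mp hp).2)]
    refine Finset.sum_congr rfl fun m hm => ?_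
    have hm' := Finset.mem_range.mp hm
    rw [Finset.mul_sum]
    refine Finset.sum_congr ?_ fun p hp => ?_
    · ext p
      simp only [Finset.HasAntidiagonal.mem_antidiagonal, Finset.mem_filter, Finset.mem_product,
        Finset.mem_range]
      omega
    · rw [(Finset.mem_filter.mp hp).2]
  rw [h1, h2, ← Finset.sum_filter_add_sum_filter_not (Finset.range K ×ˢ Finset.range K)
    (fun p => p.1 + p.2 < K)]
  ring

/-- Expanding g ∘ M_h first and then each coefficient along M'_h puts P' on the left. Since M'_h
moves the base point, the remainders must be uniform in that point. -/
lemma HasSeries.comp {K : ℕ} {M M' : ℂ → (Fin d → ℂ) → (Fin d → ℂ)}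
    {P P' : PowerSeries (Module.End ℂ (holo U))} (hM : HasSeries U K M P)
    (hM' : HasSeries U K M' P') : HasSeries U K (fun h => M h ∘ M' h) (P' * P) := by
  have hT (x) (hx : x ∈ U) : Tendsto (fun p : ℂ × (Fin d → ℂ) => (p.1, M' p.1 p.2)) (𝓝 (0, x))
      (𝓝 (0, x)) := (continuous_fst.tendsto' _ _ rfl).prodMk_nhds (hM'.tendsto x hx)
  refine ⟨fun x hx => (hM.tendsto x hx).comp (hT x hx), fun x hx g => ?_⟩
  have h1 := (hM.isBigO x hx g).comp_tendsto (hT x hx)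
  have h2 : (fun p : ℂ × (Fin d → ℂ) => ∑ k ∈ Finset.range K, p.1 ^ k *
      ((coeff k P g : (Fin d → ℂ) → ℂ) (M' p.1 p.2) - ∑ l ∈ Finset.range K, p.1 ^ l *
        (coeff l P' (coeff k P g) : (Fin d → ℂ) → ℂ) p.2)) =O[𝓝 (0, x)] fun p => p.1 ^ K := by
    refine IsBigO.fun_sum fun k _ => ?_
    have := (isBigO_fst_pow (x := x) (Nat.zero_le k)).mul (hM'.isBigO x hx (coeff k P g))
    simpa using this
  have h3 : (fun p : ℂ × (Fin d → ℂ) => ∑ q ∈ Finset.range K ×ˢ Finset.range K with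
      ¬ q.1 + q.2 < K, p.1 ^ (q.1 + q.2) * (coeff q.2 P' (coeff q.1 P g) : (Fin d → ℂ) → ℂ) p.2)
      =O[𝓝 (0, x)] fun p => p.1 ^ K := by
    refine IsBigO.fun_sum fun q hq => ?_
    have hq' := not_lt.mp (Finset.mem_filter.mp hq).2
    simpa using (isBigO_fst_pow (x := x) hq').mul
      (isBigO_one_of_holo (coeff q.2 P' (coeff q.1 P g)) hx)
  refine ((h1.add h2).add h3).congr_left fun p => ?_
  rw [sum_range_mul_antidiagonal p.1 (fun q : ℕ × ℕ =>
    (coeff q.2 P' (coeff q.1 P g) : (Fin d → ℂ) → ℂ) p.2)]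
  have h4 (m : ℕ) : (coeff m (P' * P) g : (Fin d → ℂ) → ℂ) p.2 =
      ∑ q ∈ Finset.HasAntidiagonal.antidiagonal m,
        (coeff q.2 P' (coeff q.1 P g) : (Fin d → ℂ) → ℂ) p.2 := by
    rw [PowerSeries.coeff_mul, ← Finset.Nat.sum_antidiagonal_swap, LinearMap.sum_apply,
      Submodule.coe_sum, Finset.sum_apply]
    rfl
  simp only [h4, mul_sub, Finset.sum_sub_distrib, Function.comp_apply]
  ring

lemma HasSeries.scale {K : ℕ} {M : ℂ → (Fin d → ℂ) → (Fin d → ℂ)}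
    {P : PowerSeries (Module.End ℂ (holo U))} (hM : HasSeries U K M P) (a : ℂ) :
    HasSeries U K (fun h => M (a * h)) (scaleHom a P) := by
  have hT (x : Fin d → ℂ) : Tendsto (fun p : ℂ × (Fin d → ℂ) => (a * p.1, p.2)) (𝓝 (0, x))
      (𝓝 (0, x)) := Continuous.tendsto' (by fun_prop) _ _ (by simp)
  refine ⟨fun x hx => (hM.tendsto x hx).comp (hT x), fun x hx g => ?_⟩
  have h1 : (fun p : ℂ × (Fin d → ℂ) => (a * p.1) ^ K) =O[𝓝 (0, x)] fun p => p.1 ^ K := by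
    simpa [mul_pow] using
      (isBigO_refl (fun p : ℂ × (Fin d → ℂ) => p.1 ^ K) (𝓝 (0, x))).const_mul_left (a ^ K)
  refine IsBigO.trans (((hM.isBigO x hx g).comp_tendsto (hT x)).congr_left fun p => ?_) h1
  have h2 (k : ℕ) : (coeff k (scaleHom a P) g : (Fin d → ℂ) → ℂ) p.2 =
      a ^ k * (coeff k P g : (Fin d → ℂ) → ℂ) p.2 := by
    exact congrArg (fun T : Module.End ℂ (holo U) => (T g : (Fin d → ℂ) → ℂ) p.2)
      (coeff_scaleHom a P k)
  simp only [h2, Function.comp_apply, mul_pow]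
  congr 1
  exact Finset.sum_congr rfl fun k _ => by ring

lemma HasSeries.id (K : ℕ) : HasSeries U K (fun _ => id) 1 := by
  refine ⟨fun x _ => continuous_snd.tendsto' _ _ rfl, fun x hx g => ?_⟩
  rcases K with _ | K
  · simpa using isBigO_one_of_holo g hx
  · refine (isBigO_zero _ _).congr_left fun p => ?_
    rw [Finset.sum_range_succ']
    simp [PowerSeries.coeff_one]

lemma HasSeries.composition {K : ℕ} {S : ℂ → (Fin d → ℂ) → (Fin d → ℂ)}
    {P : PowerSeries (Module.End ℂ (holo U))} (hS : HasSeries U K S P) (α : List ℂ) :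
    HasSeries U K (composition S α) ((α.map fun a => scaleHom a P).reverse.prod) := by
  induction α with
  | nil => exact HasSeries.id K
  | cons a α ih =>
    rw [List.map_cons, List.reverse_cons, List.prod_append, List.prod_singleton]
    exact (hS.scale a).comp ih

lemma HasSeries.mono {K K' : ℕ} (h : K' ≤ K) {M : ℂ → (Fin d → ℂ) → (Fin d → ℂ)}
    {P : PowerSeries (Module.End ℂ (holo U))} (hM : HasSeries U K M P) : HasSeries U K' M P := by
  refine ⟨hM.tendsto, fun x hx g => ?_⟩
  have h1 := (hM.isBigO x hx g).trans (isBigO_fst_pow h)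
  have h2 : (fun p : ℂ × (Fin d → ℂ) => ∑ k ∈ Finset.Ico K' K, p.1 ^ k *
      (coeff k P g : (Fin d → ℂ) → ℂ) p.2) =O[𝓝 (0, x)] fun p => p.1 ^ K' := by
    refine IsBigO.fun_sum fun k hk => ?_
    simpa using (isBigO_fst_pow (x := x) (Finset.mem_Ico.mp hk).1).mul
      (isBigO_one_of_holo (coeff k P g) hx)
  refine (h1.add h2).congr_left fun p => ?_
  rw [← Finset.sum_range_add_sum_Ico _ h]
  ring

lemma HasSeries.sub_isBigO {K : ℕ} {M M' : ℂ → (Fin d → ℂ) → (Fin d → ℂ)}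
    {P P' : PowerSeries (Module.End ℂ (holo U))} (hM : HasSeries U K M P)
    (hM' : HasSeries U K M' P') (h : ∀ k < K, coeff k P = coeff k P') (hU : IsOpen U)
    {x : Fin d → ℂ} (hx : x ∈ U) :
    (fun p : ℂ × (Fin d → ℂ) => M p.1 p.2 - M' p.1 p.2) =O[𝓝 (0, x)] fun p => p.1 ^ K := by
  rw [isBigO_pi]
  intro i
  refine ((hM.isBigO x hx (coord hU i)).sub (hM'.isBigO x hx (coord hU i))).congr' ?_ .rfl
  filter_upwards [(hM.tendsto x hx).eventually (hU.mem_nhds hx),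
    (hM'.tendsto x hx).eventually (hU.mem_nhds hx)] with p h1 h2
  rw [coord_apply hU i h1, coord_apply hU i h2, Finset.sum_congr rfl fun k hk => by
    rw [h k (Finset.mem_range.mp hk)]]
  simp

/-- The restriction to a fixed point. -/
lemma HasSeries.isBigO_at {K : ℕ} {M : ℂ → (Fin d → ℂ) → (Fin d → ℂ)}
    {P : PowerSeries (Module.End ℂ (holo U))} (hM : HasSeries U K M P) {x : Fin d → ℂ}
    (hx : x ∈ U) (g : holo U) :
    (fun h : ℂ => (g : (Fin d → ℂ) → ℂ) (M h x) -
      ∑ k ∈ Finset.range K, h ^ k * (coeff k P g : (Fin d → ℂ) → ℂ) x) =O[𝓝 0] fun h => h ^ K :=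
  (hM.isBigO x hx g).comp_tendsto (k := fun h : ℂ => (h, x))
    (Continuous.tendsto' (by fun_prop) _ _ rfl)

/-- Equality of coefficients from pointwise agreement. -/
lemma coeff_eq_of_isBigO {K : ℕ} {P Q : PowerSeries (Module.End ℂ (holo U))}
    (h : ∀ x ∈ U, ∀ g : holo U, (fun h : ℂ => ∑ k ∈ Finset.range K,
        h ^ k * (coeff k P g : (Fin d → ℂ) → ℂ) x - ∑ k ∈ Finset.range K,
        h ^ k * (coeff k Q g : (Fin d → ℂ) → ℂ) x) =O[𝓝 0] fun h => h ^ K) :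
    ∀ k < K, coeff k P = coeff k Q := by
  intro k hk
  refine LinearMap.ext fun g => holo_ext fun x hx => ?_
  have := eq_zero_of_sum_pow_isBigO (c := fun k => (coeff k P g : (Fin d → ℂ) → ℂ) x -
    (coeff k Q g : (Fin d → ℂ) → ℂ) x) ((h x hx g).congr_left fun z => by
      simp [mul_sub, Finset.sum_sub_distrib]) k hk
  exact sub_eq_zero.mp this

/-- Every holomorphic method that is the identity at `h = 0` has an operator series. -/
lemma exists_hasSeries (hU : IsOpen U) {S : ℂ → (Fin d → ℂ) → (Fin d → ℂ)}
    (hS : IsHolomorphicMethod U S) (h0 : ∀ x ∈ U, S 0 x = x) :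
    ∃ P : PowerSeries (Module.End ℂ (holo U)), ∀ K, HasSeries U K S P := by
  have han (g : holo U) (x) (hx : x ∈ U) : AnalyticAt ℂ (fun p : ℂ × (Fin d → ℂ) =>
      (g : (Fin d → ℂ) → ℂ) (S p.1 p.2)) (0, x) :=
    AnalyticAt.fun_comp (by simpa [h0 x hx] using analyticAt_holo g hx) (hS x hx)
  let D (k : ℕ) (g : holo U) : holo U := ⟨U.indicator fun x => (k.factorial : ℂ)⁻¹ *
    partialDeriv^[k] (fun p : ℂ × (Fin d → ℂ) => (g : (Fin d → ℂ) → ℂ) (S p.1 p.2)) (0, x),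
    indicator_mem_holo hU fun x hx => analyticAt_const.mul <|
      AnalyticAt.fun_comp (g := partialDeriv^[k] (fun p : ℂ × (Fin d → ℂ) =>
        (g : (Fin d → ℂ) → ℂ) (S p.1 p.2)))
      (analyticAt_iterate_partialDeriv (han g x hx) k) (analyticAt_const.prod analyticAt_id)⟩
  have hD (k : ℕ) (g : holo U) (x) (hx : x ∈ U) : (D k g : (Fin d → ℂ) → ℂ) x =
      (k.factorial : ℂ)⁻¹ * partialDeriv^[k] (fun p : ℂ × (Fin d → ℂ) =>
        (g : (Fin d → ℂ) → ℂ) (S p.1 p.2)) (0, x) := by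
    simp [D, hx]
  let L (k : ℕ) : Module.End ℂ (holo U) :=
    { toFun := D k
      map_add' := fun f g => holo_ext fun x hx => by
        have := (iterate_partialDeriv_add (han f x hx) (han g x hx) k).self_of_nhds
        change (D k (f + g) : (Fin d → ℂ) → ℂ) x =
          (D k f : (Fin d → ℂ) → ℂ) x + (D k g : (Fin d → ℂ) → ℂ) x
        rw [hD _ _ _ hx, hD _ _ _ hx, hD _ _ _ hx, ← mul_add]
        exact congrArg _ this
      map_smul' := fun c g => holo_ext fun x hx => by
        have := (iterate_partialDeriv_smul (han g x hx) c k).self_of_nhds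
        change (D k (c • g) : (Fin d → ℂ) → ℂ) x = c * (D k g : (Fin d → ℂ) → ℂ) x
        rw [hD _ _ _ hx, hD _ _ _ hx, mul_left_comm]
        exact congrArg _ this }
  refine ⟨PowerSeries.mk L, fun K => ⟨fun x hx => ?_, fun x hx g => ?_⟩⟩
  · simpa [ContinuousAt, h0 x hx] using (hS x hx).continuousAt
  · refine (taylor_isBigO K (han g x hx)).congr' ?_ .rfl
    filter_upwards [(continuous_snd.tendsto ((0 : ℂ), x)).eventually (hU.mem_nhds hx)] with p hp
    congr 1
    refine Finset.sum_congr rfl fun k _ => ?_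
    rw [PowerSeries.coeff_mk]
    change _ = p.1 ^ k * (D k g : (Fin d → ℂ) → ℂ) p.2
    rw [hD _ _ _ hp]

/-- The Lie derivative along `f`. -/
def lieDeriv (hU : IsOpen U) {f : (Fin d → ℂ) → (Fin d → ℂ)} (hf : AnalyticOnNhd ℂ f U) :
    Module.End ℂ (holo U) where
  toFun g := ⟨U.indicator fun x => fderiv ℂ g x (f x), indicator_mem_holo hU fun x hx => by
    have h1 : AnalyticAt ℂ (fderiv ℂ (g : (Fin d → ℂ) → ℂ)) x := (analyticAt_holo g hx).fderiv
    exact AnalyticAt.comp (g := fun q : ((Fin d → ℂ) →L[ℂ] ℂ) × (Fin d → ℂ) => q.1 q.2)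
      ((ContinuousLinearMap.id ℂ ((Fin d → ℂ) →L[ℂ] ℂ)).analyticAt_bilinear _)
      (h1.prod (hf x hx))⟩
  map_add' g k := holo_ext fun x hx => by
    simp [Set.indicator_of_mem hx, fderiv_add (analyticAt_holo g hx).differentiableAt
      (analyticAt_holo k hx).differentiableAt]
  map_smul' c g := holo_ext fun x hx => by
    simp [Set.indicator_of_mem hx, fderiv_const_smul (analyticAt_holo g hx).differentiableAt]

lemma lieDeriv_apply (hU : IsOpen U) {f : (Fin d → ℂ) → (Fin d → ℂ)} (hf : AnalyticOnNhd ℂ f U)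
    (g : holo U) {x : Fin d → ℂ} (hx : x ∈ U) :
    (lieDeriv hU hf g : (Fin d → ℂ) → ℂ) x = fderiv ℂ g x (f x) := by
  simp [lieDeriv, hx]

/-- The Lie series of the exact flow. -/
lemma flow_isBigO (hU : IsOpen U) {f : (Fin d → ℂ) → (Fin d → ℂ)} (hf : AnalyticOnNhd ℂ f U)
    {φ : ℂ → (Fin d → ℂ) → (Fin d → ℂ)} (hφ : IsExactFlow f U φ) {x : Fin d → ℂ} (hx : x ∈ U)
    (K : ℕ) (g : holo U) :
    (fun h : ℂ => (g : (Fin d → ℂ) → ℂ) (φ h x) - ∑ k ∈ Finset.range K,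
      h ^ k * (coeff k (expSeries (lieDeriv hU hf) 1) g : (Fin d → ℂ) → ℂ) x) =O[𝓝 0]
      fun h => h ^ K := by
  obtain ⟨h0, hd⟩ := hφ x hx
  have hcont : Tendsto (fun h => φ h x) (𝓝 0) (𝓝 x) := by
    simpa [ContinuousAt, h0] using hd.self_of_nhds.continuousAt
  set X := lieDeriv hU hf with hX
  suffices H : (fun h : ℂ => (g : (Fin d → ℂ) → ℂ) (φ h x) - ∑ k ∈ Finset.range K,
      h ^ k * ((k.factorial : ℂ)⁻¹ * ((X ^ k) g : (Fin d → ℂ) → ℂ) x)) =O[𝓝 0]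
      fun h => h ^ K by
    refine H.congr_left fun h => ?_
    congr 1
    refine Finset.sum_congr rfl fun k _ => ?_
    have h1 := congrArg (fun T : Module.End ℂ (holo U) => (T g : (Fin d → ℂ) → ℂ) x)
      (coeff_expSeries X 1 k)
    rw [one_pow, one_mul] at h1
    exact congrArg _ h1.symm
  induction K generalizing g with
  | zero =>
    simpa using (((analyticAt_holo g hx).continuousAt.tendsto.comp hcont).isBigO_one ℂ)
  | succ K ih =>
    -- The parameter is trivial here: the flow is only known to be differentiable in time at each
    -- fixed x, so the estimate is pointwise.
    have hfst : Tendsto (fun p : ℂ × Unit => p.1) (𝓝 (0 : ℂ) ×ˢ ⊤) (𝓝 0) := tendsto_fst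
    have hsec : Tendsto (fun h : ℂ => (h, ())) (𝓝 0) (𝓝 (0 : ℂ) ×ˢ ⊤) :=
      tendsto_id.prodMk tendsto_top
    refine (isBigO_pow_succ_of_hasDerivAt (l := (⊤ : Filter Unit)) (K := K)
      (R := fun p => (g : (Fin d → ℂ) → ℂ) (φ p.1 x) - ∑ k ∈ Finset.range (K + 1),
        p.1 ^ k * ((k.factorial : ℂ)⁻¹ * ((X ^ k) g : (Fin d → ℂ) → ℂ) x))
      (R' := fun p => (X g : (Fin d → ℂ) → ℂ) (φ p.1 x) - ∑ k ∈ Finset.range K,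
        p.1 ^ k * ((k.factorial : ℂ)⁻¹ * ((X ^ k) (X g) : (Fin d → ℂ) → ℂ) x))
      ?_ ?_ ((ih (X g)).comp_tendsto hfst)).comp_tendsto hsec
    · filter_upwards [hfst.eventually (hd.and (hcont.eventually (hU.mem_nhds hx)))] with p hp
      refine HasDerivAt.sub ?_ ?_
      · rw [hX, lieDeriv_apply hU hf g hp.2]
        exact (analyticAt_holo g hp.2).differentiableAt.hasFDerivAt.comp_hasDerivAt p.1 hp.1
      · exact hasDerivAt_sum_pow (fun k => ((X ^ k) g : (Fin d → ℂ) → ℂ) x) K p.1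
    · simp [Finset.sum_range_succ', h0]

end Operators

/-! ### Order and pseudo-symmetry of the averaged method -/

section Order

open PowerSeries (coeff)

lemma IsPerturbed.coeff_eq {A : Type*} [Ring A] [Algebra ℂ A] {N : ℕ} {x : A} {a : ℂ}
    {R : PowerSeries A} {g₁ g₂ : A} (h : IsPerturbed N x a R 0 g₁ g₂) {k : ℕ} (hk : k < N + 3) :
    coeff k R = coeff k (expSeries x a) +
      if k = N + 1 then g₁ else if k = N + 2 then g₂ else 0 := by
  obtain ⟨G, rfl, h0, h1, h2⟩ := h
  rw [map_add]
  congr 1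
  by_cases hN : N ≤ k
  · obtain ⟨j, rfl⟩ := Nat.exists_eq_add_of_le' hN
    have hj : j < 3 := by omega
    rw [PowerSeries.coeff_X_pow_mul]
    interval_cases j
    · rw [h0, if_neg (by omega), if_neg (by omega)]
    · rw [h1, if_pos (by omega)]
    · rw [h2, if_neg (by omega), if_pos (by omega)]
  · rw [PowerSeries.coeff_X_pow_mul', if_neg hN, if_neg (by omega), if_neg (by omega)]

/-- The four sequences of products of two pairs of coefficients. -/
def quadCoeffs (p q g k : ℂ) : Fin 4 → List ℂ :=
  ![[p * g, p * k, q * g, q * k], [p * k, p * g, q * k, q * g],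
    [q * k, q * g, p * k, p * g], [q * g, q * k, p * g, p * k]]

/-- The lists 0 and 1, and likewise 2 and 3, differ by exchanging g and k, which replaces g^N by
-g^N and reverses all surviving terms. -/
lemma coeff_average_quad {A : Type*} [Ring A] [Algebra ℂ A] {N : ℕ} (hN : 3 ≤ N) {x Z W : A}
    {R : ℂ → PowerSeries A}
    (hR : ∀ a, IsPerturbed N x a (R a) (a ^ N • Z) ((a ^ (N + 1) / 2) • (x * Z + Z * x))
      (a ^ (N + 2) • W)) {p q g k : ℂ} (hpq : p + q = 1) (hgk : g + k = 1)
    (hw : g ^ N + k ^ N = 0) (hv : p ^ (N + 2) + q ^ (N + 2) = 0) {Q : Fin 4 → PowerSeries A}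
    (hQ : ∀ i, Q i = ((quadCoeffs p q g k i).map R).reverse.prod) :
    (∀ i, ∀ j < N + 1, coeff j (Q i) = coeff j (expSeries x 1)) ∧
    ∀ j < N + 3, coeff j ((1 / 4 : ℂ) • (Q 0 + Q 1 + Q 2 + Q 3)) = coeff j (expSeries x 1) := by
  have hgk' := (add_comm k g).trans hgk
  have hpq' := (add_comm q p).trans hpq
  have hw' := (add_comm (k ^ N) _).trans hw
  have hv' := (add_comm (q ^ (N + 2)) _).trans hv
  have e0 := isPerturbed_quad hN hR hpq hgk hw hv
  have e1 := isPerturbed_quad hN hR hpq hgk' hw' hv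
  have e2 := isPerturbed_quad hN hR hpq' hgk' hw' hv'
  have e3 := isPerturbed_quad hN hR hpq' hgk hw hv'
  have hk : k ^ N = - g ^ N := by linear_combination hw
  rw [hk] at e1 e2
  have q0 := hQ 0
  have q1 := hQ 1
  have q2 := hQ 2
  have q3 := hQ 3
  simp only [quadCoeffs, Matrix.cons_val] at q0 q1 q2 q3
  rw [← q0] at e0
  rw [← q1] at e1
  rw [← q2] at e2
  rw [← q3] at e3
  constructor
  · intro i j hj
    fin_cases i
    · exact (e0.coeff_eq (by omega)).trans (by simp [hj.ne, show j ≠ N + 2 by omega])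
    · exact (e1.coeff_eq (by omega)).trans (by simp [hj.ne, show j ≠ N + 2 by omega])
    · exact (e2.coeff_eq (by omega)).trans (by simp [hj.ne, show j ≠ N + 2 by omega])
    · exact (e3.coeff_eq (by omega)).trans (by simp [hj.ne, show j ≠ N + 2 by omega])
  · intro j hj
    rw [PowerSeries.coeff_smul, map_add, map_add, map_add, e0.coeff_eq hj, e1.coeff_eq hj,
      e2.coeff_eq hj, e3.coeff_eq hj]
    split_ifs <;> module

variable {d : ℕ} {U : Set (Fin d → ℂ)}

/-- The average of four close methods has the average series, up to twice the order to which they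
agree. -/
lemma HasSeries.average {m : ℕ} {ψ : Fin 4 → ℂ → (Fin d → ℂ) → (Fin d → ℂ)}
    {R : Fin 4 → PowerSeries (Module.End ℂ (holo U))} (hU : IsOpen U)
    (hψ : ∀ i, HasSeries U (2 * m) (ψ i) (R i))
    (hR : ∀ i j, ∀ k < m, coeff k (R i) = coeff k (R j)) :
    HasSeries U (2 * m)
      (fun h x => (1 / 4 : ℂ) • (ψ 0 h x + ψ 1 h x + ψ 2 h x + ψ 3 h x))
      ((1 / 4 : ℂ) • (R 0 + R 1 + R 2 + R 3)) := by
  set T : ℂ → (Fin d → ℂ) → (Fin d → ℂ) :=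
    fun h x => (1 / 4 : ℂ) • (ψ 0 h x + ψ 1 h x + ψ 2 h x + ψ 3 h x) with hT
  have ht (x) (hx : x ∈ U) : Tendsto (fun p : ℂ × (Fin d → ℂ) => T p.1 p.2) (𝓝 (0, x)) (𝓝 x) := by
    have := ((((hψ 0).tendsto x hx).add ((hψ 1).tendsto x hx)).add
      ((hψ 2).tendsto x hx)).add ((hψ 3).tendsto x hx) |>.const_smul (1 / 4 : ℂ)
    convert this using 2
    module
  refine ⟨ht, fun x hx g => ?_⟩
  have hd (i j : Fin 4) : (fun p : ℂ × (Fin d → ℂ) => ψ i p.1 p.2 - ψ j p.1 p.2) =O[𝓝 (0, x)]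
      fun p => p.1 ^ m :=
    ((hψ i).mono (by omega)).sub_isBigO ((hψ j).mono (by omega)) (hR i j) hU hx
  have hT' (i : Fin 4) : (fun p : ℂ × (Fin d → ℂ) => ψ i p.1 p.2 - T p.1 p.2) =O[𝓝 (0, x)]
      fun p => p.1 ^ m := by
    refine (((((hd i 0).add (hd i 1)).add (hd i 2)).add (hd i 3)).const_smul_left
      (1 / 4 : ℂ)).congr_left fun p => ?_
    simp only [hT, Pi.smul_apply]
    module
  have hq (i : Fin 4) : (fun p : ℂ × (Fin d → ℂ) => (g : (Fin d → ℂ) → ℂ) (ψ i p.1 p.2) -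
      g.1 (T p.1 p.2) - fderiv ℂ g (T p.1 p.2) (ψ i p.1 p.2 - T p.1 p.2)) =O[𝓝 (0, x)]
      fun p => p.1 ^ (2 * m) := by
    refine ((linearization_isBigO (analyticAt_holo g hx)).comp_tendsto
      (((hψ i).tendsto x hx).prodMk_nhds (ht x hx))).trans ?_
    simpa [mul_comm 2 m, pow_mul, Function.comp_def] using (hT' i).norm_left.pow 2
  have hs (i : Fin 4) := (hψ i).isBigO x hx g
  refine (((((hs 0).add (hs 1)).add (hs 2)).add (hs 3)).const_mul_left (1 / 4)).sub
    (((((hq 0).add (hq 1)).add (hq 2)).add (hq 3)).const_mul_left (1 / 4)) |>.congr_left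
    fun p => ?_
  -- T is the mean of the four points, so the linear terms cancel and only quadratic remainders, of
  -- size h^(2m), survive.
  have hz : fderiv ℂ g.1 (T p.1 p.2) (ψ 0 p.1 p.2 - T p.1 p.2) +
      fderiv ℂ g.1 (T p.1 p.2) (ψ 1 p.1 p.2 - T p.1 p.2) +
      fderiv ℂ g.1 (T p.1 p.2) (ψ 2 p.1 p.2 - T p.1 p.2) +
      fderiv ℂ g.1 (T p.1 p.2) (ψ 3 p.1 p.2 - T p.1 p.2) = 0 := by
    rw [← map_add, ← map_add, ← map_add]
    convert map_zero (fderiv ℂ (g : (Fin d → ℂ) → ℂ) (T p.1 p.2)) using 2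
    simp only [hT]
    module
  have hc (k : ℕ) : (coeff k ((1 / 4 : ℂ) • (R 0 + R 1 + R 2 + R 3)) g : (Fin d → ℂ) → ℂ) p.2 =
      (1 / 4) * ((coeff k (R 0) g : (Fin d → ℂ) → ℂ) p.2 + (coeff k (R 1) g).1 p.2 +
        (coeff k (R 2) g).1 p.2 + (coeff k (R 3) g).1 p.2) := by
    rw [PowerSeries.coeff_smul, map_add, map_add, map_add]
    rfl
  simp only [hc, mul_add, Finset.sum_add_distrib]
  simp only [mul_left_comm _ (1 / 4 : ℂ), ← Finset.mul_sum]
  linear_combination (1 / 4) * hz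

lemma IsExactFlow.tendsto {f : (Fin d → ℂ) → (Fin d → ℂ)} {φ : ℂ → (Fin d → ℂ) → (Fin d → ℂ)}
    (hφ : IsExactFlow f U φ) {x : Fin d → ℂ} (hx : x ∈ U) :
    Tendsto (fun h => φ h x) (𝓝 0) (𝓝 x) := by
  obtain ⟨h0, hd⟩ := hφ x hx
  simpa [ContinuousAt, h0] using hd.self_of_nhds.continuousAt

/-- The order bound holds at h = 0 itself, where h^(r+1) vanishes. -/
lemma HasOrder.apply_zero {f : (Fin d → ℂ) → (Fin d → ℂ)} {φ S : ℂ → (Fin d → ℂ) → (Fin d → ℂ)}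
    (hφ : IsExactFlow f U φ) {r : ℕ} (h : HasOrder U φ S r) {x : Fin d → ℂ} (hx : x ∈ U) :
    S 0 x = x := by
  obtain ⟨C, hC⟩ := (h x hx).bound
  have := hC.self_of_nhds
  simp only [ne_eq, Nat.add_eq_zero_iff, one_ne_zero, and_false, not_false_eq_true, zero_pow,
    norm_zero, mul_zero, norm_le_zero_iff, sub_eq_zero] at this
  rw [this, (hφ x hx).1]

lemma scaleHom_neg_one_mul_self {S : ℂ → (Fin d → ℂ) → (Fin d → ℂ)}
    {P : PowerSeries (Module.End ℂ (holo U))} (hS : ∀ K, HasSeries U K S P)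
    (hsym : IsTimeSymmetric U S) : scaleHom (-1) P * P = 1 := by
  ext1 k
  refine coeff_eq_of_isBigO (K := k + 1) (fun x hx g => ?_) k (Nat.lt_succ_self k)
  have h1 := ((hS (k + 1)).comp ((hS (k + 1)).scale (-1))).isBigO_at hx g
  have h2 := (HasSeries.id (U := U) (k + 1)).isBigO_at hx g
  refine (h2.sub h1).congr' ?_ .rfl
  filter_upwards [hsym x hx] with h hh
  rw [Function.comp_apply, neg_one_mul, hh, id_eq]
  ring

lemma HasOrder.coeff_eq {f : (Fin d → ℂ) → (Fin d → ℂ)} {φ S : ℂ → (Fin d → ℂ) → (Fin d → ℂ)}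
    (hU : IsOpen U) (hf : AnalyticOnNhd ℂ f U) (hφ : IsExactFlow f U φ) {r : ℕ}
    (h : HasOrder U φ S r) {P : PowerSeries (Module.End ℂ (holo U))}
    (hS : HasSeries U (r + 1) S P) :
    ∀ k < r + 1, coeff k P = coeff k (expSeries (lieDeriv hU hf) 1) := by
  refine coeff_eq_of_isBigO fun x hx g => ?_
  have hlip : (fun h : ℂ => (g : (Fin d → ℂ) → ℂ) (S h x) - g.1 (φ h x)) =O[𝓝 0]
      fun h => h ^ (r + 1) := by
    have ht : Tendsto (fun h => (S h x, φ h x)) (𝓝 (0 : ℂ)) (𝓝 (x, x)) :=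
      ((hS.tendsto x hx).comp (Continuous.tendsto' (f := fun h : ℂ => (h, x)) (by fun_prop) 0 _
        rfl)).prodMk_nhds (hφ.tendsto hx)
    exact ((analyticAt_holo g hx).hasStrictFDerivAt.isBigO_sub.comp_tendsto ht).trans (h x hx)
  refine ((hlip.sub (hS.isBigO_at hx g)).add (flow_isBigO hU hf hφ hx (r + 1) g)).congr_left
    fun z => ?_
  ring

lemma hasOrder_of_coeff_eq {f : (Fin d → ℂ) → (Fin d → ℂ)}
    {φ S : ℂ → (Fin d → ℂ) → (Fin d → ℂ)}
    (hU : IsOpen U) (hf : AnalyticOnNhd ℂ f U) (hφ : IsExactFlow f U φ) {r : ℕ}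
    {P : PowerSeries (Module.End ℂ (holo U))} (hS : HasSeries U (r + 1) S P)
    (h : ∀ k < r + 1, coeff k P = coeff k (expSeries (lieDeriv hU hf) 1)) :
    HasOrder U φ S r := by
  intro x hx
  rw [isBigO_pi]
  intro i
  refine ((hS.isBigO_at hx (coord hU i)).sub
    (flow_isBigO hU hf hφ hx (r + 1) (coord hU i))).congr' ?_ .rfl
  have ht : Tendsto (fun h => S h x) (𝓝 (0 : ℂ)) (𝓝 x) :=
    (hS.tendsto x hx).comp (Continuous.tendsto' (f := fun h : ℂ => (h, x)) (by fun_prop) 0 _ rfl)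
  filter_upwards [ht.eventually (hU.mem_nhds hx), (hφ.tendsto hx).eventually (hU.mem_nhds hx)]
    with z h1 h2
  rw [coord_apply hU i h1, coord_apply hU i h2, Pi.sub_apply]
  have : ∑ k ∈ Finset.range (r + 1), z ^ k * (coeff k P (coord hU i) : (Fin d → ℂ) → ℂ) x =
      ∑ k ∈ Finset.range (r + 1), z ^ k *
        (coeff k (expSeries (lieDeriv hU hf) 1) (coord hU i) : (Fin d → ℂ) → ℂ) x :=
    Finset.sum_congr rfl fun k hk => by rw [← h k (Finset.mem_range.mp hk)]
  rw [this]
  ring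

lemma isPseudoSymmetric_of_series (hU : IsOpen U) {T : ℂ → (Fin d → ℂ) → (Fin d → ℂ)} {q : ℕ}
    {Q : PowerSeries (Module.End ℂ (holo U))} (hT : HasSeries U (q + 1) T Q)
    (h : ∀ k < q + 1, coeff k (scaleHom (-1) Q * Q) = coeff k 1) : IsPseudoSymmetric U T q := by
  intro x hx
  have h1 := ((hT.comp (hT.scale (-1))).sub_isBigO (HasSeries.id (q + 1)) h hU hx).comp_tendsto
    (Continuous.tendsto' (f := fun h : ℂ => (h, x)) (by fun_prop) 0 _ rfl)
  simpa [Function.comp_def] using h1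

theorem hasOrder_and_isPseudoSymmetric {n : ℕ} (hn : 1 ≤ n) {f : (Fin d → ℂ) → (Fin d → ℂ)}
    {φ S : ℂ → (Fin d → ℂ) → (Fin d → ℂ)} (hU : IsOpen U) (hf : AnalyticOnNhd ℂ f U)
    (hφ : IsExactFlow f U φ) (hS : IsHolomorphicMethod U S) (hord : HasOrder U φ S (2 * n))
    (hsym : IsTimeSymmetric U S) :
    HasOrder U φ (T₂ n S) (2 * n + 4) ∧ IsPseudoSymmetric U (T₂ n S) (4 * n + 3) := by
  obtain ⟨P, hP⟩ := exists_hasSeries hU hS fun x hx => hord.apply_zero hφ hx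
  have hPs := scaleHom_neg_one_mul_self hP hsym
  obtain ⟨Z, W, hR⟩ := isPerturbed_scaleHom (show 3 ≤ 2 * n + 1 by omega) ⟨n, rfl⟩
    (hord.coeff_eq hU hf hφ (hP _)) hPs
  set x := lieDeriv hU hf
  set p := gam (2 * n + 2) with hp
  set g := gam (2 * n) with hg
  let α := quadCoeffs p (conj p) g (conj g)
  let R : Fin 4 → PowerSeries (Module.End ℂ (holo U)) :=
    fun i => ((α i).map fun a => scaleHom a P).reverse.prod
  obtain ⟨hlow, havg⟩ := coeff_average_quad (show 3 ≤ 2 * n + 1 by omega) hR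
    (gam_add_conj (2 * n + 2)) (gam_add_conj (2 * n))
    (gam_pow_succ_add_conj (show 1 ≤ 2 * n by omega))
    (gam_pow_succ_add_conj (show 1 ≤ 2 * n + 2 by omega)) (Q := R) (fun i => rfl)
  have hinv (i j : Fin 4) (hij : α j = (α i).reverse) : scaleHom (-1) (R i) * R j = 1 := by
    have := scaleHom_neg_one_mul_reverse P hPs (α i)
    simp only [R, hij, List.map_reverse, List.reverse_reverse]
    exact this
  obtain ⟨H, hH⟩ := average_symmetric (m := 2 * n + 2) (R := R) (E := expSeries x 1)
    (fun i => let ⟨G, hG, _⟩ := exists_eq_add_X_pow_mul (hlow i); ⟨G, hG⟩)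
    (hinv 0 2 rfl) (hinv 2 0 rfl) (hinv 1 3 rfl) (hinv 3 1 rfl)
  have hT : HasSeries U (2 * (2 * n + 2)) (T₂ n S) ((1 / 4 : ℂ) • (R 0 + R 1 + R 2 + R 3)) :=
    HasSeries.average hU (ψ := fun i => composition S (α i))
      (fun i => (hP _).composition (α i))
      (fun i j k hk => (hlow i k hk).trans (hlow j k hk).symm)
  -- The agreement below h^(2n+4) has even length, and n ≥ 1 places the symmetry defect, at
  -- h^(4n+4), strictly beyond it.
  have hQ := coeff_eq_of_symmetric (r := 2 * n + 4) ⟨n + 2, by ring⟩ (by omega)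
    (show 2 * n + 4 < 2 * (2 * n + 2) by omega) havg hH
  refine ⟨hasOrder_of_coeff_eq hU hf hφ (hT.mono (by omega)) hQ,
    isPseudoSymmetric_of_series hU (hT.mono (by omega)) fun k hk => ?_⟩
  refine (congrArg (coeff k) hH).trans ?_
  rw [map_add, PowerSeries.coeff_X_pow_mul', if_neg (by omega), add_zero]

end Order

/-! ### Real methods -/

lemma tendsto_composition {d : ℕ} {U : Set (Fin d → ℂ)} {S : ℂ → (Fin d → ℂ) → (Fin d → ℂ)}
    (hS : IsHolomorphicMethod U S) {x : Fin d → ℂ} (hx : x ∈ U) (h0 : S 0 x = x) (α : List ℂ) :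
    Tendsto (fun h => composition S α h x) (𝓝 0) (𝓝 x) := by
  induction α with
  | nil => exact tendsto_const_nhds
  | cons a α ih =>
    have h1 : Tendsto (fun h : ℂ => (a * h, composition S α h x)) (𝓝 0) (𝓝 (0, x)) :=
      (Continuous.tendsto' (by fun_prop) _ _ (by simp)).prodMk_nhds ih
    have h2 := (hS x hx).continuousAt.tendsto.comp h1
    rw [h0] at h2
    exact h2

/-- Even for real h and x the inner composition is a complex point near x, so reality of S is
applied in a full neighbourhood of (0, x). -/
lemma composition_conj {d : ℕ} {U : Set (Fin d → ℂ)} {S : ℂ → (Fin d → ℂ) → (Fin d → ℂ)}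
    (hS : IsHolomorphicMethod U S) (hreal : IsRealMethod U S) {x : Fin d → ℂ} (hx : x ∈ U)
    (h0 : S 0 x = x) (hxr : star x = x) (α : List ℂ) :
    ∀ᶠ h : ℝ in 𝓝 0, composition S (α.map fun a => conj a) h x = star (composition S α h x) := by
  induction α with
  | nil => exact Eventually.of_forall fun h => hxr.symm
  | cons a α ih =>
    have hc : Tendsto (fun h : ℝ => (h : ℂ)) (𝓝 0) (𝓝 0) :=
      Complex.continuous_ofReal.tendsto' _ _ rfl
    have h1 : Tendsto (fun h : ℝ => (a * (h : ℂ), composition S α h x)) (𝓝 0) (𝓝 (0, x)) :=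
      (Continuous.tendsto' (by fun_prop) _ _ (by simp)).prodMk_nhds
        ((tendsto_composition hS hx h0 α).comp hc)
    filter_upwards [ih, h1.eventually (hreal x hx hxr)] with h hh hr
    change S (conj a * h) (composition S (α.map fun a => conj a) h x) =
      star (S (a * h) (composition S α h x))
    rw [hh, ← hr, map_mul, Complex.conj_ofReal]

lemma T₂_eq_re {d n : ℕ} {S : ℂ → (Fin d → ℂ) → (Fin d → ℂ)} {h : ℂ} {x : Fin d → ℂ}
    (h3 : composition S (coeffs₃ n) h x = star (composition S (coeffs₁ n) h x))
    (h4 : composition S (coeffs₄ n) h x = star (composition S (coeffs₂ n) h x)) :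
    T₂ n S h x = fun i => (((1 / 2 : ℝ) * (composition S (coeffs₁ n) h x i +
      composition S (coeffs₂ n) h x i).re : ℝ) : ℂ) := by
  funext i
  have hc := Complex.add_conj (composition S (coeffs₁ n) h x i + composition S (coeffs₂ n) h x i)
  rw [map_add] at hc
  simp only [T₂, h3, h4, Pi.smul_apply, Pi.add_apply, Pi.star_apply, smul_eq_mul, RCLike.star_def]
  rw [Complex.ofReal_mul]
  push_cast at hc ⊢
  linear_combination (1 / 4) * hc

end TMethod

end

theorem mainTheorem3 (n : ℕ) (hn : 1 ≤ n) :
    -- the four coefficient sequences are consistent and symmetric-conjugate, and the last two are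
    -- the complex conjugates of the first two
    (∀ α ∈ [TMethod.coeffs₁ n, TMethod.coeffs₂ n, TMethod.coeffs₃ n, TMethod.coeffs₄ n],
      TMethod.IsSymmetricConjugate α ∧ α.sum = 1) ∧
    TMethod.coeffs₃ n = (TMethod.coeffs₁ n).map (fun a => conj a) ∧
    TMethod.coeffs₄ n = (TMethod.coeffs₂ n).map (fun a => conj a) ∧
    -- the `μ_{2n+1,1}` and `μ_{2n+3,1}` terms of the two paired compositions vanish, and their
    -- (nonzero) `μ_{2n+3,2}` terms cancel
    (∃ σ₁ σ₂ m : ℝ, m ≠ 0 ∧ TMethod.HasExpansion n (TMethod.coeffs₁ n) 0 σ₁ 0 m ∧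
      TMethod.HasExpansion n (TMethod.coeffs₂ n) 0 σ₂ 0 (-m)) ∧
    -- for every time-symmetric basic method of order `2n`, the method `T_h^(2)` has order `2n+4`
    -- and is pseudo-symmetric of order `4n+3`
    (∀ (d : ℕ) (U : Set (Fin d → ℂ)) (f : (Fin d → ℂ) → (Fin d → ℂ))
      (φ S : ℂ → (Fin d → ℂ) → (Fin d → ℂ)),
      IsOpen U → AnalyticOnNhd ℂ f U → TMethod.IsExactFlow f U φ →
      TMethod.IsHolomorphicMethod U S → TMethod.HasOrder U φ S (2 * n) →
      TMethod.IsTimeSymmetric U S →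
        TMethod.HasOrder U φ (TMethod.T₂ n S) (2 * n + 4) ∧
        TMethod.IsPseudoSymmetric U (TMethod.T₂ n S) (4 * n + 3) ∧
        -- if the basic method is real, the last two compositions are the complex conjugates of the
        -- first two, and `T_h^(2)` is half the real part of the sum of the first two
        (TMethod.IsRealMethod U S → ∀ x ∈ U, star x = x → ∀ᶠ h : ℝ in 𝓝 0,
          TMethod.composition S (TMethod.coeffs₃ n) h x =
            star (TMethod.composition S (TMethod.coeffs₁ n) h x) ∧
          TMethod.composition S (TMethod.coeffs₄ n) h x =
            star (TMethod.composition S (TMethod.coeffs₂ n) h x) ∧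
          TMethod.T₂ n S h x = fun i => (((1 / 2 : ℝ) *
            (TMethod.composition S (TMethod.coeffs₁ n) h x i +
              TMethod.composition S (TMethod.coeffs₂ n) h x i).re : ℝ) : ℂ))) := by
  refine ⟨TMethod.coeffs_spec n, TMethod.coeffs₃_eq n, TMethod.coeffs₄_eq n,
    TMethod.exists_hasExpansion hn, ?_⟩
  intro d U f φ S hU hf hφ hS hord hsym
  obtain ⟨h1, h2⟩ := TMethod.hasOrder_and_isPseudoSymmetric hn hU hf hφ hS hord hsym
  refine ⟨h1, h2, fun hreal x hx hxr => ?_⟩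
  have h0 := hord.apply_zero hφ hx
  filter_upwards [TMethod.composition_conj hS hreal hx h0 hxr (TMethod.coeffs₁ n),
    TMethod.composition_conj hS hreal hx h0 hxr (TMethod.coeffs₂ n)] with h h3 h4
  rw [← TMethod.coeffs₃_eq] at h3
  rw [← TMethod.coeffs₄_eq] at h4
  exact ⟨h3, h4, TMethod.T₂_eq_re h3 h4⟩
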